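/- A weighted graph $G$ on a vertex set $V$ is given by symmetric edge weights $w(x,y)\ge 0$ ($x,y\in V$, $w(x,y)=0$ meaning that there is no edge) such that $w_x:=\sum_y w(x,y)\in(0,\infty)$ for every vertex $x$; the graph may be infinite and may have loops. For a vertex set $z$ put $w_z:=\sum_{x\in z}w_x$. The random walk on $G$ moves from $x$ to $y$ with probability $w(x,y)/w_x$, and $T_{oz}\in\{0,1,2,\dots,\infty\}$ denotes the first time that the walk started at the vertex $o$ at time $0$ visits $z$. Let $\mathrm{dist}(o,z)\in\{0,1,\dots,\infty\}$ be the graph distance. For $g>1$ let $T'$ be the time at which the biased simple random walk on $\mathbb Z$, with odds $1$ and $g$ of going left and right, started at $0$, first hits $1$ (it is the random walk on the weighted graph $\mathbb Z$ with weight $g^k$ on the edge $\{k,k+1\}$). Let $m_g:=\mathbf E\,T'$ be its mean and let $I_g(a):=\sup_{\lambda\in\mathbb R}\big(\lambda a-\log \mathbf E\,e^{\lambda T'}\big)$ be its large deviation rate function. **Corollary (Large deviations for walks in graphs).** Let $C,g>1$. As $n\to\infty$, $$\inf_G \mathbf E\,T_{oz}=m_g n+O(1),$$ and for every $a$ with $1<a<m_g$,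 $$\sup_G \mathbf P[T_{oz}\le an]=e^{-I_g(a)n+o(n)},$$ where for each integer $n\ge 0$ the infimum and the supremum are over all weighted graphs $G$ with a vertex $o$ and a vertex set $z$ satisfying $\mathrm{dist}(o,z)\ge n$ and $w_z/w_o\le C g^n$. The function $O(1)$ depends on $n,C,g$ only, and the function $o(n)$ depends on $n,C,g,a$ only. -/

import Mathlib

open MeasureTheory ProbabilityTheory Filter Asymptotics
open scoped ENNReal

universe u

noncomputable section

/-- A weighted graph on the vertex set `V`, given by its symmetric edge weights; `weight x y = 0`
means that there is no edge between `x` and `y`, and `weight x x` is the weight of a loop.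
Every vertex has positive and finite total weight, so that the random walk is defined. -/
structure WeightedGraph (V : Type u) where
  weight : V → V → ℝ≥0∞
  symm : ∀ x y, weight x y = weight y x
  total_ne_zero : ∀ x, ∑' y, weight x y ≠ 0
  total_ne_top : ∀ x, ∑' y, weight x y ≠ ∞

namespace WeightedGraph

variable {V : Type u}

/-- The weight `w_x` of a vertex: the sum of the weights of the incident edges. -/
def vertexWeight (G : WeightedGraph V) (x : V) : ℝ≥0∞ := ∑' y, G.weight x y

/-- The weight `w_z` of a set of vertices: the sum of the weights of its vertices. -/
def setWeight (G : WeightedGraph V) (z : Set V) : ℝ≥0∞ := ∑' x : z, G.vertexWeight x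

/-- The graph formed by the edges of positive weight. -/
def toSimpleGraph (G : WeightedGraph V) : SimpleGraph V where
  Adj x y := x ≠ y ∧ G.weight x y ≠ 0
  symm := ⟨fun x y h => ⟨h.1.symm, by rw [G.symm y x]; exact h.2⟩⟩
  loopless := ⟨fun _ h => h.1 rfl⟩

/-- The graph distance from a vertex to a set of vertices (`⊤` if no vertex of the set can be
reached). -/
def distToSet (G : WeightedGraph V) (o : V) (z : Set V) : ℕ∞ :=
  ⨅ x ∈ z, G.toSimpleGraph.edist o x

/-- One step of the random walk from `x`: it goes to `y` with probability
`weight x y / vertexWeight x`. -/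
def step (G : WeightedGraph V) (x : V) : PMF V :=
  PMF.normalize (G.weight x) (G.total_ne_zero x) (G.total_ne_top x)

/-- The transition kernel of the random walk. -/
def stepKernel [MeasurableSpace V] [DiscreteMeasurableSpace V] (G : WeightedGraph V) :
    Kernel V V where
  toFun x := (G.step x).toMeasure
  measurable' := Measurable.of_discrete

instance [MeasurableSpace V] [DiscreteMeasurableSpace V] (G : WeightedGraph V) :
    IsMarkovKernel G.stepKernel :=
  ⟨fun x => inferInstanceAs (IsProbabilityMeasure (G.step x).toMeasure)⟩

/-- The law, on the space of trajectories `ℕ → V`, of the random walk started at `o` at time `0`. -/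
def walkLaw [MeasurableSpace V] [DiscreteMeasurableSpace V] (G : WeightedGraph V) (o : V) :
    Measure (ℕ → V) :=
  Kernel.traj (X := fun _ => V)
    (fun n => G.stepKernel.comap (fun p => p ⟨n, Finset.mem_Iic.2 le_rfl⟩)
      (measurable_pi_apply _)) 0 (fun _ => o)

/-- The first time at which a trajectory visits the set `z` (`⊤` if it never does). -/
def hitTime (z : Set V) (ω : ℕ → V) : ℕ∞ := ⨅ (k : ℕ) (_ : ω k ∈ z), (k : ℕ∞)

/-- The expected value of `F T`, with `T` the hitting time of `z` by the random walk started
at `o`. Vertex sets carry the discrete σ-algebra. -/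
def expectHit (G : WeightedGraph V) (o : V) (z : Set V) (F : ℕ∞ → ℝ≥0∞) : ℝ≥0∞ :=
  letI : MeasurableSpace V := ⊤
  haveI : DiscreteMeasurableSpace V := ⟨fun _ => trivial⟩
  ∫⁻ ω, F (hitTime z ω) ∂(G.walkLaw o)

/-- `E T`, with `T` the hitting time of `z` by the random walk started at `o`. -/
def meanHit (G : WeightedGraph V) (o : V) (z : Set V) : ℝ≥0∞ :=
  G.expectHit o z fun t => (t : ℝ≥0∞)

/-- `P[T ≤ t]`, with `T` the hitting time of `z` by the random walk started at `o`. -/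
def probHitLE (G : WeightedGraph V) (o : V) (z : Set V) (t : ℝ) : ℝ≥0∞ :=
  letI : MeasurableSpace V := ⊤
  haveI : DiscreteMeasurableSpace V := ⟨fun _ => trivial⟩
  G.walkLaw o {ω | (((hitTime z ω : ℕ∞) : ℝ≥0∞) : EReal) ≤ (t : EReal)}

/-- The constraints on the weighted graph, the starting vertex and the target set:
`n ≤ dist(o, z)` and `w_z / w_o ≤ C g ^ n`. -/
def Admissible (C g : ℝ) (n : ℕ) (G : WeightedGraph V) (o : V) (z : Set V) : Prop :=
  (n : ℕ∞) ≤ G.distToSet o z ∧ G.setWeight z / G.vertexWeight o ≤ ENNReal.ofReal (C * g ^ n)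

/-- The infimum of `E T` over all weighted graphs satisfying the constraints. -/
def infMeanHit (C g : ℝ) (n : ℕ) : ℝ≥0∞ :=
  ⨅ (V : Type u) (G : WeightedGraph V) (o : V) (z : Set V) (_ : Admissible C g n G o z),
    G.meanHit o z

/-- The supremum of `P[T ≤ t]` over all weighted graphs satisfying the constraints. -/
def supProbHitLE (C g : ℝ) (n : ℕ) (t : ℝ) : ℝ≥0∞ :=
  ⨆ (V : Type u) (G : WeightedGraph V) (o : V) (z : Set V) (_ : Admissible C g n G o z),
    G.probHitLE o z t

end WeightedGraph

/-- Edge weights of the biased walk on the integers: `g ^ k` on the edge `{k, k + 1}`. -/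
def biasedWeight (g : ℝ) (i j : ℤ) : ℝ≥0∞ :=
  if j = i + 1 then ENNReal.ofReal (g ^ i) else if i = j + 1 then ENNReal.ofReal (g ^ j) else 0

/-- The integers with weight `g ^ k` on the edge `{k, k + 1}`; its random walk is the biased simple
random walk with odds `1` and `g` of going left and right. -/
def biasedLine (g : ℝ) (hg : 1 < g) : WeightedGraph ℤ where
  weight := biasedWeight g
  symm i j := by
    unfold biasedWeight
    split_ifs <;> first | rfl | omega
  total_ne_zero i := by
    have h : biasedWeight g i (i + 1) ≠ 0 := by
      simp only [biasedWeight, if_true]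
      exact (ENNReal.ofReal_pos.2 (zpow_pos (by linarith) _)).ne'
    exact fun h0 => h (ENNReal.tsum_eq_zero.1 h0 _)
  total_ne_top i := by
    rw [tsum_eq_sum (s := {i - 1, i + 1})]
    · refine (ENNReal.sum_lt_top.2 fun j _ => ?_).ne
      unfold biasedWeight
      split_ifs <;> simp
    · intro j hj
      simp only [Finset.mem_insert, Finset.mem_singleton, not_or] at hj
      unfold biasedWeight
      rw [if_neg hj.2, if_neg (by omega)]

/-- `m_g`: the mean of the time `T'` at which the biased walk started at `0` hits `1`. -/
def biasedMean (g : ℝ) (hg : 1 < g) : ℝ :=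
  ((biasedLine g hg).meanHit 0 {1}).toReal

/-- `log E exp(l T')`, with values in `[-∞, ∞]`. -/
def biasedLogMGF (g : ℝ) (hg : 1 < g) (l : ℝ) : EReal :=
  ENNReal.log ((biasedLine g hg).expectHit 0 {1} fun t =>
    EReal.exp ((l : EReal) * ((t : ℝ≥0∞) : EReal)))

/-- `I_g(a)`: the large deviation rate function of `T'`, that is, the Legendre transform
`sup_l (l a - log E exp(l T'))` over all real `l`. -/
def biasedRate (g : ℝ) (hg : 1 < g) (a : ℝ) : ℝ :=
  (⨆ l : ℝ, ((l * a : ℝ) : EReal) - biasedLogMGF g hg l).toReal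

end

/-! Let s = e^σ < 1, F = E s^T and u(x) = E_x s^T, and let v be the discounted Green function of the
walk from o killed at z, normalised to be symmetric. By reversibility, f(x,y) = s w(x,y) v(x) u(y)
is a flow from o to z of strength F whose total mass is E[T s^T] = dF/dσ. Working with s < 1 keeps
all sums finite.

On an edge with a = f(x,y) and b = f(y,x), log(a/b) is the drop of log(v/u) from x to y, and
(a+b)/(a-b) = m(a/b), where m(γ) = (γ+1)/(γ-1) is a convex function of log γ. Its tangent at log γ,
with intercept M and slope -c, gives a + b ≥ (a-b)(M - c log(a/b)) when a ≥ b. Hence the potential M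
dist(·,z) - c log(v/u) drops by at most (a+b)/(a-b) along the net flow, and summation by parts
yields dF/dσ ≥ F (M n - c log(R/F²) - O(1)) with R = C g^n (`hitGenDeriv_lower`). The potential has
to be truncated near z, where v = 0, and adjusted at o.

For γ = g F^(-2/n) the bound becomes dF/dσ ≥ F m(γ)(n - K). Thus L = (log F)/n satisfies L' ≥ m(g
e^(-2L))(1 - K/n); with K = 0 and equality this is the equation for the biased walk. Comparison up
to σ = 0 (`logDiscount_le_of_deriv`) bounds E s^T by that of the biased walk at a discount changed
by the factor 1 - K/n (`hitGen_le`). Letting σ → 0 bounds the mean (`le_meanHit`), and Chernoff's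
inequality bounds the probability (`probHitLE_le`).

The biased line with o = 0 and z = {n} gives the opposite bounds: its mean is computed in
`meanHit_line_le`, and its hitting probability dominates a binomial one (`binomialProb_le_line`).
The rate function is evaluated in `biasedRate_eq`, with l < 0 parametrised by L. -/

noncomputable section

/-! ### The law of the hitting time in terms of the killed transition operator -/

namespace WeightedGraph

variable {V : Type u}

lemma lintegral_step_toMeasure [MeasurableSpace V] [DiscreteMeasurableSpace V] (G : WeightedGraph V)
    (x : V) (f : V → ℝ≥0∞) :
    ∫⁻ y, f y ∂(G.step x).toMeasure = ∑' y, G.step x y * f y := by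
  have h : (G.step x).toMeasure = Measure.sum fun y => G.step x y • Measure.dirac y := by
    ext s hs
    rw [PMF.toMeasure_apply _ hs, Measure.sum_apply _ hs]
    refine tsum_congr fun y => ?_
    by_cases hy : y ∈ s <;> simp [hs, hy]
  rw [h, lintegral_sum_measure]
  refine tsum_congr fun y => ?_
  rw [lintegral_smul_measure, lintegral_dirac, smul_eq_mul]

/-- The simple Markov property of the random walk at time `k`. -/
lemma lintegral_walkLaw_succ [MeasurableSpace V] [DiscreteMeasurableSpace V] (G : WeightedGraph V)
    (o : V) (k : ℕ) (h : (Finset.Iic k → V) → ℝ≥0∞) (hh : Measurable h) (f : V → ℝ≥0∞) :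
    ∫⁻ ω, h (Preorder.frestrictLe k ω) * f (ω (k + 1)) ∂G.walkLaw o =
      ∫⁻ ω, h (Preorder.frestrictLe k ω) * (∑' y, G.step (ω k) y * f y) ∂G.walkLaw o := by
  have hf : Measurable f := .of_discrete
  set F : V → ℝ≥0∞ := fun x => ∑' y, G.step x y * f y with hF
  have hFm : Measurable F := .of_discrete
  set κ : (n : ℕ) → Kernel (Finset.Iic n → V) V := fun n =>
    G.stepKernel.comap (fun p => p ⟨n, Finset.mem_Iic.2 le_rfl⟩) (measurable_pi_apply _) with hκ
  have hW : G.walkLaw o = Kernel.traj (X := fun _ => V) κ 0 (fun _ => o) := rfl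
  have m1 : Measurable (Preorder.frestrictLe₂ (π := fun _ => V) k.le_succ) :=
    Preorder.measurable_frestrictLe₂ _
  have m2 : Measurable (IicProdIoc (X := fun _ => V) k (k + 1)) := measurable_IicProdIoc
  have m3 : Measurable fun p : Finset.Iic (k + 1) → V =>
      h (Preorder.frestrictLe₂ (π := fun _ => V) k.le_succ p) *
        f (p ⟨k + 1, Finset.mem_Iic.2 le_rfl⟩) :=
    (hh.comp m1).mul (hf.comp (measurable_pi_apply _))
  have e1 : ∫⁻ ω, h (Preorder.frestrictLe k ω) * f (ω (k + 1)) ∂G.walkLaw o =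
      ∫⁻ p, h (Preorder.frestrictLe₂ (π := fun _ => V) (k.le_succ) p) * f (p ⟨k + 1, Finset.mem_Iic.2 le_rfl⟩)
        ∂(Kernel.partialTraj (X := fun _ => V) κ 0 (k + 1) (fun _ => o)) := by
    rw [hW, ← Kernel.traj_map_frestrictLe_apply, lintegral_map]
    · rfl
    · exact m3
    · fun_prop
  have e2 : ∫⁻ ω, h (Preorder.frestrictLe k ω) * F (ω k) ∂G.walkLaw o =
      ∫⁻ p, h p * F (p ⟨k, Finset.mem_Iic.2 le_rfl⟩)
        ∂(Kernel.partialTraj (X := fun _ => V) κ 0 k (fun _ => o)) := by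
    rw [hW, ← Kernel.traj_map_frestrictLe_apply, lintegral_map]
    · rfl
    · exact hh.mul (hFm.comp (by fun_prop))
    · fun_prop
  rw [e1, e2, Kernel.partialTraj_succ_of_le (Nat.zero_le k), Kernel.lintegral_map,
    Kernel.lintegral_comp]
  rotate_left
  · exact m3.comp m2
  · exact m2
  · exact m3
  refine lintegral_congr fun p => ?_
  rw [Kernel.lintegral_id_prod]
  rotate_left
  · exact m3.comp m2
  have key : ∀ c : (Finset.Ioc k (k + 1)) → V,
      h (Preorder.frestrictLe₂ (π := fun _ => V) (k.le_succ) (IicProdIoc (X := fun _ => V) k (k + 1) (p, c))) *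
        f (IicProdIoc (X := fun _ => V) k (k + 1) (p, c) ⟨k + 1, Finset.mem_Iic.2 le_rfl⟩) =
      h p * f (c ⟨k + 1, by simp⟩) := by
    intro c
    have h1 : Preorder.frestrictLe₂ (π := fun _ => V) (k.le_succ) (IicProdIoc (X := fun _ => V) k (k + 1) (p, c)) = p :=
      congrFun (frestrictLe₂_comp_IicProdIoc (X := fun _ => V) (k.le_succ)) (p, c)
    rw [h1]
    simp [IicProdIoc]
  simp_rw [key]
  rw [Kernel.lintegral_map, lintegral_const_mul]
  · congr 1
    exact lintegral_step_toMeasure G _ _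
  · exact hf.comp (by fun_prop)
  · fun_prop
  · exact measurable_const.mul (hf.comp (by fun_prop))

/-- The transition operator of the walk killed on entering `z`. -/
def killed (G : WeightedGraph V) (z : Set V) (f : V → ℝ≥0∞) (x : V) : ℝ≥0∞ :=
  ∑' y, G.step x y * zᶜ.indicator f y

/-- The probability of entering `z` in the next step. -/
def enter (G : WeightedGraph V) (z : Set V) (x : V) : ℝ≥0∞ :=
  ∑' y, G.step x y * z.indicator 1 y

lemma lintegral_walkLaw_zero [MeasurableSpace V] [DiscreteMeasurableSpace V] (G : WeightedGraph V)
    (o : V) (f : V → ℝ≥0∞) : ∫⁻ ω, f (ω 0) ∂G.walkLaw o = f o := by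
  set κ : (n : ℕ) → Kernel (Finset.Iic n → V) V := fun n =>
    G.stepKernel.comap (fun p => p ⟨n, Finset.mem_Iic.2 le_rfl⟩) (measurable_pi_apply _) with hκ
  have hf : Measurable f := .of_discrete
  have hW : G.walkLaw o = Kernel.traj (X := fun _ => V) κ 0 (fun _ => o) := rfl
  have e2 : ∫⁻ ω, f (ω 0) ∂G.walkLaw o =
      ∫⁻ p, f (p ⟨0, Finset.mem_Iic.2 le_rfl⟩)
        ∂(Kernel.partialTraj (X := fun _ => V) κ 0 0 (fun _ => o)) := by
    rw [hW, ← Kernel.traj_map_frestrictLe_apply, lintegral_map]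
    · rfl
    · exact (hf.comp (by fun_prop))
    · fun_prop
  rw [e2, Kernel.partialTraj_self, Kernel.id_apply, lintegral_dirac']
  exact (hf.comp (by fun_prop))

/-- The walk avoids `z` up to time `k`. -/
def avoids (z : Set V) (k : ℕ) : Set (ℕ → V) := {ω | ∀ j ≤ k, ω j ∉ z}

/-- Induction on the time: the Markov property turns the last step into one application of the
killed operator. It reduces the law of T to powers of a positive operator. -/
lemma lintegral_avoids [MeasurableSpace V] [DiscreteMeasurableSpace V] (G : WeightedGraph V)
    (z : Set V) (o : V) (ho : o ∉ z) (k : ℕ) (f : V → ℝ≥0∞) :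
    ∫⁻ ω, (avoids z k).indicator 1 ω * f (ω k) ∂G.walkLaw o = (G.killed z)^[k] f o := by
  induction k generalizing f with
  | zero =>
    have h : ∀ ω : ℕ → V, (avoids z 0).indicator 1 ω * f (ω 0) = zᶜ.indicator f (ω 0) := by
      intro ω
      by_cases h : ω 0 ∈ z <;> simp [avoids, h, Set.indicator]
    simp_rw [h]
    rw [lintegral_walkLaw_zero]
    simp [ho]
  | succ k ih =>
    have h : ∀ ω : ℕ → V, (avoids z (k + 1)).indicator 1 ω * f (ω (k + 1)) =
        {p : Finset.Iic k → V | ∀ j, p j ∉ z}.indicator 1 (Preorder.frestrictLe k ω) *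
          zᶜ.indicator f (ω (k + 1)) := by
      intro ω
      have : ω ∈ avoids z (k + 1) ↔ (Preorder.frestrictLe k ω ∈ {p : Finset.Iic k → V | ∀ j, p j ∉ z})
          ∧ ω (k + 1) ∈ zᶜ := by
        simp only [avoids, Set.mem_ofPred_eq, Preorder.frestrictLe_apply, Subtype.forall,
          Finset.mem_Iic, Set.mem_compl_iff]
        constructor
        · exact fun h => ⟨fun j hj => h j (by omega), h _ le_rfl⟩
        · rintro ⟨h1, h2⟩ j hj
          rcases Nat.lt_or_ge k j with h | h
          · obtain rfl : j = k + 1 := by omega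
            exact h2
          · exact h1 j h
      by_cases h1 : Preorder.frestrictLe k ω ∈ {p : Finset.Iic k → V | ∀ j, p j ∉ z} <;>
      by_cases h2 : ω (k + 1) ∈ zᶜ <;>
      simp only [Set.indicator, this, h1, h2] <;> simp
    simp_rw [h]
    rw [lintegral_walkLaw_succ]
    · rw [Function.iterate_succ_apply, ← ih]
      refine lintegral_congr fun ω => ?_
      congr 1
      by_cases h1 : ω ∈ avoids z k
      · rw [Set.indicator_of_mem h1, Set.indicator_of_mem]
        · rfl
        · exact fun j => h1 j (Finset.mem_Iic.1 j.2)
      · rw [Set.indicator_of_notMem h1, Set.indicator_of_notMem]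
        exact fun h => h1 fun j hj => h ⟨j, Finset.mem_Iic.2 hj⟩
    · refine measurable_one.indicator ?_
      have : {p : Finset.Iic k → V | ∀ j, p j ∉ z} = ⋂ j, (fun p => p j) ⁻¹' zᶜ := by
        ext; simp
      rw [this]
      exact MeasurableSet.iInter fun j => (measurable_pi_apply j) (MeasurableSet.of_discrete)

lemma measurableSet_avoids [MeasurableSpace V] [DiscreteMeasurableSpace V] (z : Set V) (k : ℕ) :
    MeasurableSet (avoids z k) := by
  have : avoids z k = ⋂ j, ⋂ (_ : j ≤ k), (fun ω : ℕ → V => ω j) ⁻¹' zᶜ := by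
    ext; simp [avoids]
  rw [this]
  exact MeasurableSet.iInter fun j => MeasurableSet.iInter fun _ =>
    (measurable_pi_apply j) (MeasurableSet.of_discrete)

lemma hitTime_le_iff (z : Set V) (ω : ℕ → V) (k : ℕ) : hitTime z ω ≤ k ↔ ω ∉ avoids z k := by
  constructor
  · intro h hk
    have : ((k + 1 : ℕ) : ℕ∞) ≤ hitTime z ω := by
      refine le_iInf fun j => le_iInf fun hj => ?_
      by_contra! hlt
      exact hk j (by exact_mod_cast Order.lt_add_one_iff.1 (by exact_mod_cast hlt)) hj
    have h2 := this.trans h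
    norm_cast at h2
    omega
  · intro h
    simp only [avoids, Set.mem_ofPred_eq, not_forall, not_not] at h
    obtain ⟨j, hj, hz⟩ := h
    exact (iInf_le_of_le j (iInf_le _ hz)).trans (by exact_mod_cast hj)

lemma measurable_hitTime [MeasurableSpace V] [DiscreteMeasurableSpace V] (z : Set V) :
    Measurable (hitTime z) := by
  have hle : ∀ k : ℕ, MeasurableSet {ω | hitTime z ω ≤ k} := fun k => by
    have : {ω | hitTime z ω ≤ k} = (avoids z k)ᶜ := by
      ext ω; exact hitTime_le_iff z ω k
    rw [this]
    exact (measurableSet_avoids z k).compl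
  refine measurable_to_countable' fun t => ?_
  induction t using ENat.recTopCoe with
  | top =>
    have : hitTime z ⁻¹' {⊤} = ⋂ k : ℕ, {ω | hitTime z ω ≤ k}ᶜ := by
      ext ω
      simp [ENat.eq_top_iff_forall_gt]
    rw [this]
    exact MeasurableSet.iInter fun k => (hle k).compl
  | coe k =>
    have : hitTime z ⁻¹' {(k : ℕ∞)} = {ω | hitTime z ω ≤ k} \ ⋃ j < k, {ω | hitTime z ω ≤ j} := by
      ext ω
      simp only [Set.mem_preimage, Set.mem_singleton_iff, Set.mem_sdiff, Set.mem_ofPred_eq,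
        Set.mem_iUnion, exists_prop, not_exists, not_and, not_le]
      constructor
      · intro h
        exact ⟨h.le, fun j hj => by rw [h]; exact_mod_cast hj⟩
      · rintro ⟨h1, h2⟩
        refine h1.antisymm (le_of_not_gt fun h3 => ?_)
        lift hitTime z ω to ℕ using (h3.trans_le le_top).ne with j
        exact lt_irrefl _ (h2 j (by exact_mod_cast h3))
    rw [this]
    exact (hle k).diff (MeasurableSet.iUnion fun j => MeasurableSet.iUnion fun _ => hle j)

/-- The probability that the walk started at `o ∉ z` hits `z` at time `k + 1`. -/
def hitProb (G : WeightedGraph V) (z : Set V) (k : ℕ) (o : V) : ℝ≥0∞ :=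
  (G.killed z)^[k] (G.enter z) o

lemma walkLaw_avoids [MeasurableSpace V] [DiscreteMeasurableSpace V] (G : WeightedGraph V)
    (z : Set V) (o : V) (ho : o ∉ z) (k : ℕ) :
    G.walkLaw o (avoids z k) = (G.killed z)^[k] 1 o := by
  rw [← lintegral_avoids G z o ho, ← lintegral_indicator_one (measurableSet_avoids z k)]
  simp

lemma killed_one_add_enter (G : WeightedGraph V) (z : Set V) (x : V) :
    G.killed z 1 x + G.enter z x = 1 := by
  rw [killed, enter, ← ENNReal.tsum_add, ← (G.step x).tsum_coe]
  refine tsum_congr fun y => ?_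
  by_cases h : y ∈ z <;> simp [h]

lemma killed_add (G : WeightedGraph V) (z : Set V) (f h : V → ℝ≥0∞) :
    G.killed z (f + h) = G.killed z f + G.killed z h := by
  ext x
  simp only [killed, Pi.add_apply, ← ENNReal.tsum_add]
  refine tsum_congr fun y => ?_
  by_cases h : y ∈ z <;> simp [h, mul_add]

lemma killed_mono (G : WeightedGraph V) (z : Set V) : Monotone (G.killed z) := by
  intro f h hfh x
  refine ENNReal.tsum_le_tsum fun y => mul_le_mul_right ?_ _
  exact Set.indicator_le_indicator (hfh y)

lemma killed_const_mul (G : WeightedGraph V) (z : Set V) (c : ℝ≥0∞) (f : V → ℝ≥0∞) :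
    G.killed z (fun y => c * f y) = fun x => c * G.killed z f x := by
  ext x
  simp only [killed, ← ENNReal.tsum_mul_left]
  refine tsum_congr fun y => ?_
  by_cases h : y ∈ z <;> simp [h, mul_left_comm]

lemma killed_tsum (G : WeightedGraph V) (z : Set V) {ι : Type*} (f : ι → V → ℝ≥0∞) :
    G.killed z (fun y => ∑' i, f i y) = fun x => ∑' i, G.killed z (f i) x := by
  ext x
  simp only [killed]
  rw [ENNReal.tsum_comm]
  refine tsum_congr fun y => ?_
  by_cases h : y ∈ z <;> simp [h, ENNReal.tsum_mul_left]

lemma killed_iterate_add (G : WeightedGraph V) (z : Set V) (f h : V → ℝ≥0∞) (k : ℕ) :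
    (G.killed z)^[k] (f + h) = (G.killed z)^[k] f + (G.killed z)^[k] h := by
  induction k generalizing f h with
  | zero => rfl
  | succ k ih => rw [Function.iterate_succ_apply, killed_add, ih]; rfl

lemma killed_iterate_tsum (G : WeightedGraph V) (z : Set V) {ι : Type*} (f : ι → V → ℝ≥0∞) (k : ℕ) :
    (G.killed z)^[k] (fun y => ∑' i, f i y) = fun x => ∑' i, (G.killed z)^[k] (f i) x := by
  induction k generalizing f with
  | zero => rfl
  | succ k ih => rw [Function.iterate_succ_apply, killed_tsum, ih]; rfl

lemma killed_iterate_const_mul (G : WeightedGraph V) (z : Set V) (c : ℝ≥0∞) (f : V → ℝ≥0∞) (k : ℕ) :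
    (G.killed z)^[k] (fun y => c * f y) = fun x => c * (G.killed z)^[k] f x := by
  induction k generalizing f with
  | zero => rfl
  | succ k ih => rw [Function.iterate_succ_apply, killed_const_mul, ih]; rfl

lemma killed_iterate_mono (G : WeightedGraph V) (z : Set V) (k : ℕ) :
    Monotone ((G.killed z)^[k]) := (G.killed_mono z).iterate k

lemma killed_one_le (G : WeightedGraph V) (z : Set V) : G.killed z 1 ≤ 1 := fun x =>
  (le_self_add).trans (killed_one_add_enter G z x).le

lemma killed_iterate_one_le (G : WeightedGraph V) (z : Set V) (k : ℕ) :
    (G.killed z)^[k] 1 ≤ 1 := by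
  induction k with
  | zero => exact le_rfl
  | succ k ih =>
    rw [Function.iterate_succ_apply']
    exact (G.killed_mono z ih).trans (G.killed_one_le z)

/-- Surviving to time `k` is either surviving to time `k + 1` or hitting at time `k + 1`. -/
lemma killed_iterate_one_eq (G : WeightedGraph V) (z : Set V) (k : ℕ) (x : V) :
    (G.killed z)^[k] 1 x = (G.killed z)^[k + 1] 1 x + G.hitProb z k x := by
  rw [Function.iterate_succ_apply, hitProb, ← Pi.add_apply ((G.killed z)^[k] _),
    ← killed_iterate_add]
  rw [show G.killed z 1 + G.enter z = 1 from funext (killed_one_add_enter G z)]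

lemma sum_hitProb_add (G : WeightedGraph V) (z : Set V) (k : ℕ) (x : V) :
    ∑ j ∈ Finset.range k, G.hitProb z j x + (G.killed z)^[k] 1 x = 1 := by
  induction k with
  | zero => simp
  | succ k ih =>
    rw [Finset.sum_range_succ, add_assoc, add_comm (G.hitProb z k x), ← killed_iterate_one_eq, ih]

lemma tsum_hitProb_le (G : WeightedGraph V) (z : Set V) (x : V) : ∑' j, G.hitProb z j x ≤ 1 := by
  rw [ENNReal.tsum_eq_iSup_nat]
  exact iSup_le fun k => le_self_add.trans (sum_hitProb_add G z k x).le

lemma walkLaw_hitTime_succ [MeasurableSpace V] [DiscreteMeasurableSpace V] (G : WeightedGraph V)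
    (z : Set V) (o : V) (ho : o ∉ z) (k : ℕ) :
    G.walkLaw o {ω | hitTime z ω = (k + 1 : ℕ)} = G.hitProb z k o := by
  have h : {ω | hitTime z ω = (k + 1 : ℕ)} = avoids z k \ avoids z (k + 1) := by
    ext ω
    have h1 := hitTime_le_iff z ω k
    have h2 := hitTime_le_iff z ω (k + 1)
    rw [Set.mem_sdiff, ← h2, h1.symm.not_right, not_le]
    simp only [Set.mem_ofPred_eq]
    induction hitTime z ω using ENat.recTopCoe with
    | top => simpa using (ENat.natCast_ne_top (k + 1)).symm
    | coe j => norm_cast; omega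
  have hsub : avoids z (k + 1) ⊆ avoids z k := fun ω h j hj => h j (by omega)
  have h1 : G.walkLaw o (avoids z (k + 1)) ≠ ∞ := by
    rw [walkLaw_avoids G z o ho]
    exact ((killed_iterate_one_le G z (k + 1) o).trans_lt ENNReal.one_lt_top).ne
  rw [h, measure_sdiff hsub (measurableSet_avoids z _).nullMeasurableSet h1, walkLaw_avoids G z o ho,
    walkLaw_avoids G z o ho, killed_iterate_one_eq G z k o]
  rw [walkLaw_avoids G z o ho] at h1
  exact ENNReal.add_sub_cancel_left h1

lemma walkLaw_hitTime_zero [MeasurableSpace V] [DiscreteMeasurableSpace V] (G : WeightedGraph V)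
    (z : Set V) (o : V) (ho : o ∉ z) : G.walkLaw o {ω | hitTime z ω = 0} = 0 := by
  have h : {ω | hitTime z ω = 0} = (avoids z 0)ᶜ := by
    ext ω
    simp [← hitTime_le_iff]
  have h1 := walkLaw_avoids G z o ho 0
  rw [h, measure_compl (measurableSet_avoids z 0) (by rw [h1]; simp), h1]
  have : IsProbabilityMeasure (G.walkLaw o) := by unfold walkLaw; infer_instance
  simp

/-- The probability that the walk started at `o ∉ z` never hits `z`. -/
def missProb (G : WeightedGraph V) (z : Set V) (o : V) : ℝ≥0∞ := 1 - ∑' j, G.hitProb z j o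

lemma missProb_add (G : WeightedGraph V) (z : Set V) (o : V) :
    G.missProb z o + ∑' j, G.hitProb z j o = 1 :=
  tsub_add_cancel_of_le (tsum_hitProb_le G z o)

instance [MeasurableSpace V] [DiscreteMeasurableSpace V] (G : WeightedGraph V) (o : V) :
    IsProbabilityMeasure (G.walkLaw o) := by
  unfold walkLaw; infer_instance

lemma lintegral_comp_hitTime [MeasurableSpace V] [DiscreteMeasurableSpace V] (G : WeightedGraph V)
    (z : Set V) (o : V) (F : ℕ∞ → ℝ≥0∞) :
    ∫⁻ ω, F (hitTime z ω) ∂G.walkLaw o = F ⊤ * G.walkLaw o {ω | hitTime z ω = ⊤} +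
      ∑' k : ℕ, F k * G.walkLaw o {ω | hitTime z ω = k} := by
  have hm : ∀ t : ℕ∞, MeasurableSet {ω : ℕ → V | hitTime z ω = t} := fun t =>
    measurable_hitTime z (measurableSet_singleton t)
  have hp : ∀ ω : ℕ → V, F (hitTime z ω) = {ω | hitTime z ω = ⊤}.indicator (fun _ => F ⊤) ω +
      ∑' k : ℕ, {ω | hitTime z ω = k}.indicator (fun _ => F k) ω := by
    intro ω
    simp only [Set.indicator, Set.mem_ofPred_eq]
    generalize hitTime z ω = t
    induction t using ENat.recTopCoe with
    | top => simp
    | coe j =>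
      rw [tsum_eq_single j]
      · simp
      · intro i hi
        rw [if_neg]
        exact_mod_cast hi.symm
  simp_rw [hp]
  rw [lintegral_add_left (measurable_const.indicator (hm _)),
    lintegral_tsum fun k => (measurable_const.indicator (hm _)).aemeasurable]
  simp_rw [lintegral_indicator_const (hm _)]

lemma walkLaw_hitTime_top [MeasurableSpace V] [DiscreteMeasurableSpace V] (G : WeightedGraph V)
    (z : Set V) (o : V) (ho : o ∉ z) : G.walkLaw o {ω | hitTime z ω = ⊤} = G.missProb z o := by
  have h := lintegral_comp_hitTime G z o 1
  rw [tsum_eq_zero_add' ENNReal.summable] at h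
  simp only [Pi.one_apply, lintegral_const, measure_univ, one_mul, Nat.cast_zero,
    walkLaw_hitTime_zero G z o ho, walkLaw_hitTime_succ G z o ho, zero_add] at h
  rw [missProb, h]
  exact (ENNReal.add_sub_cancel_right
    ((tsum_hitProb_le G z o).trans_lt ENNReal.one_lt_top).ne).symm

/-- The index k stands for the time k + 1. The atom at `⊤` is kept: it makes the mean infinite
whenever z is missed with positive probability. -/
lemma expectHit_eq (G : WeightedGraph V) (z : Set V) (o : V) (ho : o ∉ z) (F : ℕ∞ → ℝ≥0∞) :
    G.expectHit o z F = F ⊤ * G.missProb z o + ∑' k : ℕ, F (k + 1 : ℕ) * G.hitProb z k o := by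
  let _ : MeasurableSpace V := ⊤
  have : DiscreteMeasurableSpace V := ⟨fun _ => trivial⟩
  unfold expectHit
  rw [lintegral_comp_hitTime, tsum_eq_zero_add' ENNReal.summable]
  simp only [Nat.cast_zero, walkLaw_hitTime_zero G z o ho, walkLaw_hitTime_succ G z o ho, zero_add,
    walkLaw_hitTime_top G z o ho, mul_zero]

lemma probHitLE_eq (G : WeightedGraph V) (z : Set V) (o : V) (ho : o ∉ z) (t : ℝ) (ht : 0 ≤ t) :
    G.probHitLE o z t = ∑ k ∈ Finset.range ⌊t⌋₊, G.hitProb z k o := by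
  let _ : MeasurableSpace V := ⊤
  have : DiscreteMeasurableSpace V := ⟨fun _ => trivial⟩
  unfold probHitLE
  have h : {ω | (((hitTime z ω : ℕ∞) : ℝ≥0∞) : EReal) ≤ (t : EReal)} = (avoids z ⌊t⌋₊)ᶜ := by
    ext ω
    rw [Set.mem_compl_iff, ← hitTime_le_iff]
    simp only [Set.mem_ofPred_eq]
    induction hitTime z ω using ENat.recTopCoe with
    | top => simp
    | coe j =>
      rw [Nat.cast_le, Nat.le_floor_iff ht]
      simp only [ENat.toENNReal_coe]
      have : (((j : ℝ≥0∞)) : EReal) = ((j : ℝ) : EReal) := by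
        rw [← ENNReal.ofReal_natCast, EReal.coe_ennreal_ofReal, max_eq_left (Nat.cast_nonneg j)]
      rw [this, EReal.coe_le_coe_iff]
  have h1 := walkLaw_avoids G z o ho ⌊t⌋₊
  have h2 : G.walkLaw o (avoids z ⌊t⌋₊) ≠ ∞ := measure_ne_top _ _
  rw [h, measure_compl (measurableSet_avoids z _) h2, measure_univ, h1]
  rw [h1] at h2
  rw [← sum_hitProb_add G z ⌊t⌋₊ o]
  exact ENNReal.add_sub_cancel_right h2

/-- `E T` is the sum of the survival probabilities. -/
lemma meanHit_eq (G : WeightedGraph V) (z : Set V) (o : V) (ho : o ∉ z) :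
    G.meanHit o z = ∑' k, (G.killed z)^[k] 1 o := by
  let _ : MeasurableSpace V := ⊤
  have : DiscreteMeasurableSpace V := ⟨fun _ => trivial⟩
  unfold meanHit expectHit
  simp_rw [← walkLaw_avoids G z o ho]
  have hp : ∀ ω : ℕ → V, ((hitTime z ω : ℕ∞) : ℝ≥0∞) =
      ∑' k : ℕ, (avoids z k).indicator 1 ω := by
    intro ω
    have hi : ∀ k : ℕ, (avoids z k).indicator (1 : (ℕ → V) → ℝ≥0∞) ω =
        if (k : ℕ∞) < hitTime z ω then 1 else 0 := fun k => by
      classical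
      rw [Set.indicator_apply, if_congr ((hitTime_le_iff z ω k).symm.not_right.trans not_le) rfl rfl]
      rfl
    simp_rw [hi]
    generalize hitTime z ω = t
    induction t using ENat.recTopCoe with
    | top => simp
    | coe j =>
      rw [tsum_eq_sum (s := Finset.range j)]
      · rw [Finset.sum_congr rfl (g := fun _ => 1)]
        · simp
        · intro x hx
          rw [if_pos]
          exact_mod_cast Finset.mem_range.1 hx
      · intro x hx
        rw [if_neg]
        simpa using hx
  simp_rw [hp]
  rw [lintegral_tsum fun k => (measurable_one.indicator (measurableSet_avoids z k)).aemeasurable]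
  simp_rw [lintegral_indicator_one (measurableSet_avoids z _)]

/-! ### Reversibility, voltage and the discounted flow -/

lemma vertexWeight_ne_zero (G : WeightedGraph V) (x : V) : G.vertexWeight x ≠ 0 :=
  G.total_ne_zero x

lemma vertexWeight_ne_top (G : WeightedGraph V) (x : V) : G.vertexWeight x ≠ ∞ :=
  G.total_ne_top x

lemma weight_le_vertexWeight (G : WeightedGraph V) (x y : V) :
    G.weight x y ≤ G.vertexWeight x := ENNReal.le_tsum y

lemma weight_ne_top (G : WeightedGraph V) (x y : V) : G.weight x y ≠ ∞ :=
  ((G.weight_le_vertexWeight x y).trans_lt (G.vertexWeight_ne_top x).lt_top).ne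

lemma step_apply (G : WeightedGraph V) (x y : V) :
    G.step x y = G.weight x y * (G.vertexWeight x)⁻¹ := PMF.normalize_apply ..

lemma vertexWeight_mul_step (G : WeightedGraph V) (x y : V) :
    G.vertexWeight x * G.step x y = G.weight x y := by
  rw [step_apply, mul_left_comm,
    ENNReal.mul_inv_cancel (G.vertexWeight_ne_zero x) (G.vertexWeight_ne_top x), mul_one]

/-- The killed transition operator is self-adjoint with respect to the vertex weights. -/
lemma killed_symm (G : WeightedGraph V) (z : Set V) (f h : V → ℝ≥0∞) :
    ∑' x, zᶜ.indicator (fun x => G.vertexWeight x * (G.killed z f x * h x)) x =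
      ∑' x, zᶜ.indicator (fun x => G.vertexWeight x * (f x * G.killed z h x)) x := by
  have h1 : ∀ x, zᶜ.indicator (fun x => G.vertexWeight x * (G.killed z f x * h x)) x =
      ∑' y, G.weight x y * (zᶜ.indicator f y * zᶜ.indicator h x) := by
    intro x
    by_cases hx : x ∈ z
    · simp [hx]
    · simp only [Set.mem_compl_iff, hx, not_false_eq_true, Set.indicator_of_mem, killed]
      rw [← ENNReal.tsum_mul_right, ← ENNReal.tsum_mul_left]
      refine tsum_congr fun y => ?_
      rw [← G.vertexWeight_mul_step x y]
      ring
  have h2 : ∀ x, zᶜ.indicator (fun x => G.vertexWeight x * (f x * G.killed z h x)) x =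
      ∑' y, G.weight x y * (zᶜ.indicator f x * zᶜ.indicator h y) := by
    intro x
    by_cases hx : x ∈ z
    · simp [hx]
    · simp only [Set.mem_compl_iff, hx, not_false_eq_true, Set.indicator_of_mem, killed]
      rw [← ENNReal.tsum_mul_left, ← ENNReal.tsum_mul_left]
      refine tsum_congr fun y => ?_
      rw [← G.vertexWeight_mul_step x y]
      ring
  simp_rw [h1, h2]
  rw [ENNReal.tsum_comm]
  refine tsum_congr fun x => tsum_congr fun y => ?_
  rw [G.symm]

lemma killed_iterate_symm (G : WeightedGraph V) (z : Set V) (f h : V → ℝ≥0∞) (k : ℕ) :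
    ∑' x, zᶜ.indicator (fun x => G.vertexWeight x * ((G.killed z)^[k] f x * h x)) x =
      ∑' x, zᶜ.indicator (fun x => G.vertexWeight x * (f x * (G.killed z)^[k] h x)) x := by
  induction k generalizing h with
  | zero => rfl
  | succ k ih =>
    rw [Function.iterate_succ_apply', killed_symm, ih, Function.iterate_succ_apply]

/-- The generating function `E_x s^T` of the hitting time, for `x ∉ z`. -/
def hitGen (G : WeightedGraph V) (z : Set V) (s : ℝ≥0∞) (x : V) : ℝ≥0∞ :=
  ∑' k, s ^ (k + 1) * G.hitProb z k x

/-- `E_x[T s^T]`, for `x ∉ z`. -/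
def hitGenDeriv (G : WeightedGraph V) (z : Set V) (s : ℝ≥0∞) (x : V) : ℝ≥0∞ :=
  ∑' k : ℕ, (k + 1) * (s ^ (k + 1) * G.hitProb z k x)

open Classical in
/-- `E_x s^T` for all `x`. -/
def discount (G : WeightedGraph V) (z : Set V) (s : ℝ≥0∞) (x : V) : ℝ≥0∞ :=
  if x ∈ z then 1 else G.hitGen z s x

open Classical in
/-- The voltage at `x` of the discounted unit current from `o` to `z`. -/
def voltage (G : WeightedGraph V) (z : Set V) (o : V) (s : ℝ≥0∞) (x : V) : ℝ≥0∞ :=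
  if x ∈ z then 0 else
    (∑' k, s ^ k * (G.killed z)^[k] (fun y => if y = o then 1 else 0) x) / G.vertexWeight o

lemma hitProb_succ (G : WeightedGraph V) (z : Set V) (k : ℕ) :
    G.hitProb z (k + 1) = G.killed z (G.hitProb z k) := by
  ext x
  exact congrFun (Function.iterate_succ_apply' (G.killed z) k (G.enter z)) x

lemma hitGen_eq (G : WeightedGraph V) (z : Set V) (s : ℝ≥0∞) (x : V) :
    G.hitGen z s x = s * (G.enter z x + G.killed z (G.hitGen z s) x) := by
  have h : G.hitGen z s = fun y => ∑' k, s ^ (k + 1) * G.hitProb z k y := rfl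
  conv_rhs => rw [h, killed_tsum]
  simp only [killed_const_mul]
  rw [hitGen, tsum_eq_zero_add' ENNReal.summable, mul_add, ← ENNReal.tsum_mul_left]
  simp only [hitProb_succ, pow_succ, zero_add, pow_zero, one_mul]
  congr 1
  refine tsum_congr fun k => ?_
  ring

lemma discount_eq (G : WeightedGraph V) (z : Set V) (s : ℝ≥0∞) {x : V} (hx : x ∉ z) :
    G.discount z s x = s * ∑' y, G.step x y * G.discount z s y := by
  rw [discount, if_neg hx, hitGen_eq, enter, killed, ← ENNReal.tsum_add]
  congr 1
  refine tsum_congr fun y => ?_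
  by_cases hy : y ∈ z <;> simp [hy, discount]

lemma vertexWeight_mul_discount (G : WeightedGraph V) (z : Set V) (s : ℝ≥0∞) {x : V} (hx : x ∉ z) :
    G.vertexWeight x * G.discount z s x = s * ∑' y, G.weight x y * G.discount z s y := by
  rw [G.discount_eq z s hx, mul_left_comm, ← ENNReal.tsum_mul_left]
  simp_rw [← mul_assoc, vertexWeight_mul_step]

-- The Green series h = Σ s^k K^k δ_o of the killed operator K satisfies h = δ_o + s K h. After
-- division by w_o this is Kirchhoff's node law with a unit source at o.
open Classical in
lemma vertexWeight_mul_voltage (G : WeightedGraph V) (z : Set V) (o : V) (s : ℝ≥0∞) {x : V}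
    (hx : x ∉ z) :
    G.vertexWeight x * G.voltage z o s x =
      (if x = o then 1 else 0) + s * ∑' y, G.weight x y * G.voltage z o s y := by
  set δ : V → ℝ≥0∞ := fun y => if y = o then 1 else 0 with hδ
  set g : V → ℝ≥0∞ := fun x => ∑' k, s ^ k * (G.killed z)^[k] δ x with hg
  have hg' : g x = δ x + s * G.killed z g x := by
    rw [hg, killed_tsum]
    simp only [killed_const_mul]
    rw [tsum_eq_zero_add' ENNReal.summable, ← ENNReal.tsum_mul_left]
    simp only [Function.iterate_succ_apply', pow_succ, pow_zero, one_mul, Function.iterate_zero, id]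
    congr 1
    refine tsum_congr fun k => ?_
    ring
  have hv : ∀ y, G.voltage z o s y = zᶜ.indicator g y * (G.vertexWeight o)⁻¹ := by
    intro y
    by_cases hy : y ∈ z <;> simp [voltage, hy, hg, div_eq_mul_inv, hδ]
  have hvx : G.voltage z o s x = g x * (G.vertexWeight o)⁻¹ := by rw [hv]; simp [hx]
  rw [hvx, hg', add_mul, mul_add]
  congr 1
  · by_cases hxo : x = o
    · subst hxo
      simp [hδ, ENNReal.mul_inv_cancel (G.vertexWeight_ne_zero x) (G.vertexWeight_ne_top x)]
    · simp [hδ, hxo]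
  · rw [killed, ← ENNReal.tsum_mul_left, ← ENNReal.tsum_mul_left, ← ENNReal.tsum_mul_right,
      ← ENNReal.tsum_mul_left]
    refine tsum_congr fun y => ?_
    rw [hv, ← vertexWeight_mul_step]
    ring

lemma hitGen_le_one (G : WeightedGraph V) (z : Set V) {s : ℝ≥0∞} (hs : s ≤ 1) (x : V) :
    G.hitGen z s x ≤ 1 := by
  refine le_trans (ENNReal.tsum_le_tsum fun k => ?_) (G.tsum_hitProb_le z x)
  exact mul_le_of_le_one_left' (pow_le_one' hs _)

lemma discount_le_one (G : WeightedGraph V) (z : Set V) {s : ℝ≥0∞} (hs : s ≤ 1) (x : V) :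
    G.discount z s x ≤ 1 := by
  rw [discount]
  split_ifs
  exacts [le_rfl, G.hitGen_le_one z hs x]

lemma voltage_ne_top (G : WeightedGraph V) (z : Set V) (o : V) {s : ℝ≥0∞} (hs : s < 1) (x : V) :
    G.voltage z o s x ≠ ∞ := by
  classical
  rw [voltage]
  split_ifs
  · simp
  refine (ENNReal.div_lt_top ?_ (G.vertexWeight_ne_zero o)).ne
  have : ∑' k, s ^ k * (G.killed z)^[k] (fun y => if y = o then 1 else 0) x ≤ ∑' k, s ^ k := by
    refine ENNReal.tsum_le_tsum fun k => mul_le_of_le_one_right' ?_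
    refine ((G.killed_iterate_mono z k) ?_ x).trans (G.killed_iterate_one_le z k x)
    intro y
    by_cases hy : y = o <;> simp [hy]
  refine (this.trans_lt ?_).ne
  rw [ENNReal.tsum_geometric]
  exact ENNReal.inv_lt_top.2 (tsub_pos_of_lt hs)

/-- Self-adjointness moves the killed operator from the unit mass at o onto h. Thus w_x v(x) is the
discounted expected number of visits to x before z. -/
lemma tsum_vertexWeight_voltage (G : WeightedGraph V) (z : Set V) (o : V) (ho : o ∉ z) (s : ℝ≥0∞)
    (h : V → ℝ≥0∞) :
    ∑' x, G.vertexWeight x * G.voltage z o s x * h x = ∑' k, s ^ k * (G.killed z)^[k] h o := by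
  classical
  set δ : V → ℝ≥0∞ := fun y => if y = o then 1 else 0 with hδ
  have h1 : ∀ k, (G.killed z)^[k] h o = ∑' x, zᶜ.indicator
      (fun x => G.vertexWeight x * ((G.killed z)^[k] δ x * h x)) x / G.vertexWeight o := by
    intro k
    simp_rw [div_eq_mul_inv]
    rw [ENNReal.tsum_mul_right, killed_iterate_symm, tsum_eq_single o]
    · simp only [Set.mem_compl_iff, ho, not_false_eq_true, Set.indicator_of_mem, hδ, if_true,
        one_mul]
      rw [mul_comm, ← mul_assoc,
        ENNReal.inv_mul_cancel (G.vertexWeight_ne_zero o) (G.vertexWeight_ne_top o), one_mul]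
    · intro x hx
      simp [hδ, hx]
  simp_rw [h1, ← ENNReal.tsum_mul_left]
  rw [ENNReal.tsum_comm]
  refine tsum_congr fun x => ?_
  by_cases hx : x ∈ z
  · simp [voltage, hx]
  · simp only [voltage, hx, if_false, Set.mem_compl_iff, not_false_eq_true, Set.indicator_of_mem,
      div_eq_mul_inv]
    rw [← ENNReal.tsum_mul_right, ← ENNReal.tsum_mul_left, ← ENNReal.tsum_mul_right]
    refine tsum_congr fun k => ?_
    ring

/-- Running k steps and then hitting after j + 1 more is hitting at time k + j + 1. The time m + 1
arises from m + 1 pairs (k, j), which produces the factor T in E[T s^T]. -/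
lemma tsum_vertexWeight_voltage_discount (G : WeightedGraph V) (z : Set V) (o : V) (ho : o ∉ z)
    (s : ℝ≥0∞) :
    ∑' x, G.vertexWeight x * G.voltage z o s x * G.discount z s x = G.hitGenDeriv z s o := by
  have h0 : ∀ x, G.vertexWeight x * G.voltage z o s x * G.discount z s x =
      G.vertexWeight x * G.voltage z o s x * G.hitGen z s x := by
    intro x
    by_cases hx : x ∈ z <;> simp [voltage, discount, hx]
  simp_rw [h0]
  rw [tsum_vertexWeight_voltage G z o ho]
  have h1 : ∀ k, s ^ k * (G.killed z)^[k] (G.hitGen z s) o =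
      ∑' j, s ^ (k + j + 1) * G.hitProb z (k + j) o := by
    intro k
    have h : G.hitGen z s = fun y => ∑' j, s ^ (j + 1) * G.hitProb z j y := rfl
    rw [h, killed_iterate_tsum]
    simp only [killed_iterate_const_mul, ← ENNReal.tsum_mul_left]
    refine tsum_congr fun j => ?_
    have : (G.killed z)^[k] (G.hitProb z j) o = G.hitProb z (k + j) o :=
      (congrFun (Function.iterate_add_apply (G.killed z) k j (G.enter z)) o).symm
    rw [this]
    ring
  simp_rw [h1]
  rw [← ENNReal.tsum_prod (f := fun k j => s ^ (k + j + 1) * G.hitProb z (k + j) o),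
    ← Finset.HasAntidiagonal.sigmaAntidiagonalEquivProd.tsum_eq, ENNReal.tsum_sigma', hitGenDeriv]
  refine tsum_congr fun m => ?_
  rw [tsum_congr (g := fun _ => s ^ (m + 1) * G.hitProb z m o)]
  · rw [tsum_fintype]
    simp
  · rintro ⟨⟨a, b⟩, hab⟩
    obtain rfl : a + b = m := by simpa using hab
    rfl

lemma hitGenDeriv_ne_top (G : WeightedGraph V) (z : Set V) (o : V) (ho : o ∉ z)
    {s : ℝ≥0∞} (hs : s < 1) : G.hitGenDeriv z s o ≠ ∞ := by
  rw [← tsum_vertexWeight_voltage_discount G z o ho, tsum_vertexWeight_voltage G z o ho]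
  have : ∑' k, s ^ k * (G.killed z)^[k] (G.discount z s) o ≤ ∑' k, s ^ k := by
    refine ENNReal.tsum_le_tsum fun k => mul_le_of_le_one_right' ?_
    exact ((G.killed_iterate_mono z k) (G.discount_le_one z hs.le) o).trans
      (G.killed_iterate_one_le z k o)
  refine (this.trans_lt ?_).ne
  rw [ENNReal.tsum_geometric]
  exact ENNReal.inv_lt_top.2 (tsub_pos_of_lt hs)

/-- The discounted flow of the conditioned walk along the directed edge from `x` to `y`. -/
def flow (G : WeightedGraph V) (z : Set V) (o : V) (s : ℝ≥0∞) (x y : V) : ℝ≥0∞ :=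
  s * G.weight x y * G.voltage z o s x * G.discount z s y

/-- Off z this is the mean value property of `discount`; on z both sides vanish with the voltage. -/
lemma tsum_flow_left (G : WeightedGraph V) (z : Set V) (o : V) (s : ℝ≥0∞) (x : V) :
    ∑' y, G.flow z o s x y = G.vertexWeight x * G.voltage z o s x * G.discount z s x := by
  by_cases hx : x ∈ z
  · simp [flow, voltage, hx]
  · rw [mul_right_comm, vertexWeight_mul_discount G z s hx, mul_right_comm,
      ← ENNReal.tsum_mul_left]
    refine tsum_congr fun y => ?_
    rw [flow]
    ring

-- Together with `tsum_flow_left` this says that the flow is conserved off z, apart from a source of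
-- strength E_o s^T at o.
open Classical in
lemma tsum_flow_right (G : WeightedGraph V) (z : Set V) (o : V) (s : ℝ≥0∞) {y : V} (hy : y ∉ z) :
    ∑' x, G.flow z o s x y + (if y = o then G.discount z s o else 0) =
      G.vertexWeight y * G.voltage z o s y * G.discount z s y := by
  rw [vertexWeight_mul_voltage G z o s hy, add_mul, add_comm]
  congr 1
  · by_cases h : y = o
    · simp [h]
    · simp [h]
  · rw [← ENNReal.tsum_mul_left, ← ENNReal.tsum_mul_right]
    refine tsum_congr fun x => ?_
    rw [flow, G.symm]
    ring

lemma tsum_flow (G : WeightedGraph V) (z : Set V) (o : V) (ho : o ∉ z) (s : ℝ≥0∞) :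
    ∑' x, ∑' y, G.flow z o s x y = G.hitGenDeriv z s o := by
  simp_rw [tsum_flow_left]
  exact tsum_vertexWeight_voltage_discount G z o ho s

/-- Summation by parts for the discounted flow. -/
lemma tsum_flow_mul (G : WeightedGraph V) (z : Set V) (o : V) (ho : o ∉ z) (s : ℝ≥0∞)
    (ψ : V → ℝ≥0∞) (hψ : ∀ x ∈ z, ψ x = 0) :
    ∑' x, ∑' y, G.flow z o s x y * ψ y + G.hitGen z s o * ψ o =
      ∑' x, ∑' y, G.flow z o s x y * ψ x := by
  classical
  rw [ENNReal.tsum_comm]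
  simp_rw [ENNReal.tsum_mul_right, tsum_flow_left]
  have h : G.hitGen z s o * ψ o = ∑' y, (if y = o then G.discount z s o else 0) * ψ y := by
    rw [tsum_eq_single o]
    · simp [discount, ho]
    · intro y hy
      simp [hy]
  rw [h, ← ENNReal.tsum_add]
  refine tsum_congr fun y => ?_
  by_cases hy : y ∈ z
  · simp [hψ y hy]
  · rw [← add_mul, tsum_flow_right G z o s hy]

end WeightedGraph

/-! ### The convexity inequality on a single edge -/

/-- The mean passage time per unit distance of the biased walk with odds `1` and `γ`. -/
def biasedSlowness (γ : ℝ) : ℝ := (γ + 1) / (γ - 1)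

/-- Minus the derivative of `biasedSlowness` in the logarithm of the bias. -/
def slownessSlope (γ : ℝ) : ℝ := 2 * γ / (γ - 1) ^ 2

/-- The intercept of the tangent of `biasedSlowness`, as a function of the logarithm of the bias. -/
def slownessIntercept (γ : ℝ) : ℝ := biasedSlowness γ + slownessSlope γ * Real.log γ

lemma slownessSlope_pos {γ : ℝ} (hγ : 1 < γ) : 0 < slownessSlope γ := by
  have : 0 < γ - 1 := by linarith
  unfold slownessSlope; positivity

lemma one_le_biasedSlowness {γ : ℝ} (hγ : 1 < γ) : 1 ≤ biasedSlowness γ := by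
  rw [biasedSlowness, le_div_iff₀ (by linarith)]
  linarith

lemma slownessIntercept_pos {γ : ℝ} (hγ : 1 < γ) : 0 < slownessIntercept γ := by
  have := mul_pos (slownessSlope_pos hγ) (Real.log_pos hγ)
  have := one_le_biasedSlowness hγ
  unfold slownessIntercept
  linarith

/-- This is (a+b)/(a-b) = m(a/b) ≥ tangent of m at log γ, multiplied by a - b. After log t ≤ t - 1
at t = γb/a, the remaining defect is a perfect square over a positive number. -/
lemma sub_mul_intercept_le {γ a b : ℝ} (hγ : 1 < γ) (hb : 0 < b) (hab : b ≤ a) :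
    (a - b) * (slownessIntercept γ - slownessSlope γ * Real.log (a / b)) ≤ a + b := by
  have ha : 0 < a := hb.trans_le hab
  have hγ0 : 0 < γ := by linarith
  have hγ1 : 0 < γ - 1 := by linarith
  have h1 : Real.log γ - Real.log (a / b) ≤ γ * b / a - 1 := by
    have h2 := Real.log_le_sub_one_of_pos (show 0 < γ * b / a by positivity)
    have h3 : Real.log (γ * b / a) = Real.log γ - Real.log (a / b) := by
      rw [Real.log_div (by positivity) (by positivity), Real.log_mul (by positivity) (by positivity),
        Real.log_div (by positivity) (by positivity)]
      ring
    linarith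
  have h4 : slownessIntercept γ - slownessSlope γ * Real.log (a / b) ≤
      biasedSlowness γ + slownessSlope γ * (γ * b / a - 1) := by
    have := mul_le_mul_of_nonneg_left h1 (slownessSlope_pos hγ).le
    unfold slownessIntercept
    linarith
  refine (mul_le_mul_of_nonneg_left h4 (by linarith)).trans ?_
  have h5 : a + b - (a - b) * (biasedSlowness γ + slownessSlope γ * (γ * b / a - 1)) =
      2 * (γ * b - a) ^ 2 / (a * (γ - 1) ^ 2) := by
    unfold biasedSlowness slownessSlope
    field_simp
    ring
  have h6 : 0 ≤ 2 * (γ * b - a) ^ 2 / (a * (γ - 1) ^ 2) := by positivity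
  linarith

lemma clamp_sub_le {B t₁ t₂ : ℝ} (h : t₂ ≤ t₁) :
    min (max t₁ 0) B - min (max t₂ 0) B ≤ t₁ - t₂ := by
  rcases le_total t₁ 0 with h1 | h1 <;> rcases le_total t₂ 0 with h2 | h2 <;>
  simp only [max_eq_left, max_eq_right, h1, h2] <;>
  rcases min_cases (max t₁ 0) B with h3 | h3 <;> rcases min_cases (max t₂ 0) B with h4 | h4 <;>
  simp_all <;> grind

lemma clamp_mono {B t₁ t₂ : ℝ} (h : t₂ ≤ t₁) : min (max t₂ 0) B ≤ min (max t₁ 0) B :=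
  min_le_min_right _ (max_le_max_right _ h)

/-- Clamping is monotone and 1-Lipschitz. A potential that drops along the net flow therefore keeps
its bound, and one that rises contributes a nonpositive amount. -/
lemma sub_mul_clamp_le_of_le {γ a b B t₁ t₂ : ℝ} (hγ : 1 < γ) (hb : 0 < b) (hab : b ≤ a)
    (h : t₁ - t₂ ≤ slownessIntercept γ - slownessSlope γ * Real.log (a / b)) :
    (a - b) * (min (max t₁ 0) B - min (max t₂ 0) B) ≤ a + b := by
  rcases le_total t₂ t₁ with ht | ht
  · exact (mul_le_mul_of_nonneg_left ((clamp_sub_le ht).trans h) (by linarith)).trans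
      (sub_mul_intercept_le hγ hb hab)
  · have := clamp_mono (B := B) ht
    nlinarith

/-- The edge inequality for the clamped potential. -/
lemma sub_mul_clamp_le {γ a b B t₁ t₂ : ℝ} (hγ : 1 < γ) (ha : 0 < a) (hb : 0 < b)
    (h₁ : t₁ - t₂ ≤ slownessIntercept γ - slownessSlope γ * Real.log (a / b))
    (h₂ : t₂ - t₁ ≤ slownessIntercept γ - slownessSlope γ * Real.log (b / a)) :
    (a - b) * (min (max t₁ 0) B - min (max t₂ 0) B) ≤ a + b := by
  rcases le_total b a with hab | hab
  · exact sub_mul_clamp_le_of_le hγ hb hab h₁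
  · have := sub_mul_clamp_le_of_le (B := B) hγ ha hab h₂
    linarith

/-- The edge inequality at the starting point, where half of the flow is to spare. -/
lemma sub_mul_clamp_top_le {γ a b t₁ t₂ : ℝ} (hγ : 1 < γ) (ha : 0 < a) (hb : 0 < b)
    (h : t₁ - t₂ ≤ slownessIntercept γ / 2 - slownessSlope γ * Real.log (a / b)) :
    (a - b) * (min (max t₁ 0) (max t₁ 0) - min (max t₂ 0) (max t₁ 0)) + a / 2 ≤ a + b := by
  have h0 : min (max t₂ 0) (max t₁ 0) ≤ min (max t₁ 0) (max t₁ 0) := by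
    rw [min_self]; exact min_le_right _ _
  rcases le_total b a with hab | hab
  · rcases le_total t₂ t₁ with ht | ht
    · have h1 := mul_le_mul_of_nonneg_left ((clamp_sub_le (B := max t₁ 0) ht).trans h)
        (sub_nonneg.2 hab)
      have h2 := sub_mul_intercept_le hγ hb hab
      -- Giving up half of the logarithm bounds the product by half of the tangent estimate, (a + b)
      -- / 2, so that the additional a / 2 still fits under a + b.
      have h3 : 0 ≤ (a - b) * (slownessSlope γ * Real.log (a / b)) :=
        mul_nonneg (by linarith) (mul_nonneg (slownessSlope_pos hγ).le
          (Real.log_nonneg ((one_le_div hb).2 hab)))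
      nlinarith
    · have := clamp_mono (B := max t₁ 0) ht
      nlinarith
  · nlinarith

/-- It will be applied to t = w_o v(o), the discounted number of visits to o, which has no upper
bound. The logarithm is absorbed by the spare half of the flow leaving o. -/
lemma mul_log_le_half_add {c t : ℝ} (hc : 0 < c) (ht : 0 < t) :
    c * Real.log t ≤ t / 2 + 2 * c ^ 2 := by
  have h1 : Real.log t ≤ t / (2 * c) - 1 + Real.log (2 * c) := by
    have := Real.log_le_sub_one_of_pos (show 0 < t / (2 * c) by positivity)
    rw [Real.log_div (by positivity) (by positivity)] at this
    linarith
  have h2 := Real.log_le_sub_one_of_pos (show 0 < 2 * c by positivity)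
  have h3 : c * Real.log t ≤ c * (t / (2 * c) + (2 * c)) :=
    mul_le_mul_of_nonneg_left (by linarith) hc.le
  have h4 : c * (t / (2 * c) + (2 * c)) = t / 2 + 2 * c ^ 2 := by field_simp
  linarith

/-! ### The differential inequality for the generating function -/

namespace WeightedGraph

variable {V : Type u}

open Classical in
/-- Summing an edge inequality for the discounted flow. -/
lemma hitGenDeriv_bound (G : WeightedGraph V) (z : Set V) (o : V) (ho : o ∉ z) {s : ℝ≥0∞}
    (hs : s < 1) (ψ : V → ℝ≥0∞) (hψ : ∀ x ∈ z, ψ x = 0) (hψo : ∀ x, ψ x ≤ ψ o) (hψt : ψ o ≠ ∞)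
    (ε : ℝ≥0∞)
    (hedge : ∀ x y, G.flow z o s x y * ψ x + G.flow z o s y x * ψ y +
      2⁻¹ * ((if x = o then G.flow z o s x y else 0) + (if y = o then G.flow z o s y x else 0)) ≤
      G.flow z o s x y + G.flow z o s y x + G.flow z o s x y * ψ y + G.flow z o s y x * ψ x +
      ε * (z.indicator (fun y => G.weight y x) y + z.indicator (fun x => G.weight x y) x)) :
    2 * (G.hitGen z s o * ψ o) + G.hitGen z s o * (G.vertexWeight o * G.voltage z o s o) ≤
      2 * G.hitGenDeriv z s o + 2 * (ε * G.setWeight z) := by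
  set X := ∑' x, ∑' y, G.flow z o s x y * ψ x with hX
  set Y := ∑' x, ∑' y, G.flow z o s x y * ψ y with hY
  have hXY : Y + G.hitGen z s o * ψ o = X := tsum_flow_mul G z o ho s ψ hψ
  -- The hypothesis that ψ is largest at o serves to make X, hence Y, finite; 2 * Y can then be
  -- cancelled.
  have hXt : X ≠ ∞ := by
    have : X ≤ G.hitGenDeriv z s o * ψ o := by
      rw [← tsum_flow G z o ho, ← ENNReal.tsum_mul_right]
      refine ENNReal.tsum_le_tsum fun x => ?_
      rw [← ENNReal.tsum_mul_right]
      exact ENNReal.tsum_le_tsum fun y => mul_le_mul_right (hψo x) _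
    exact (this.trans_lt (ENNReal.mul_lt_top (G.hitGenDeriv_ne_top z o ho hs).lt_top
      hψt.lt_top)).ne
  have hYt : Y ≠ ∞ := fun h => hXt (by rw [← hXY, h, top_add])
  -- Ordered pairs count every edge twice, which accounts for the factors 2 in the conclusion.
  have hsum := ENNReal.tsum_le_tsum fun x => ENNReal.tsum_le_tsum fun y => hedge x y
  simp only [ENNReal.tsum_add, ENNReal.tsum_mul_left] at hsum
  have e1 : ∑' x, ∑' y, G.flow z o s y x * ψ y = X := ENNReal.tsum_comm
  have e2 : ∑' x, ∑' y, G.flow z o s y x * ψ x = Y := ENNReal.tsum_comm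
  have e3 : ∑' x, ∑' y, G.flow z o s y x = G.hitGenDeriv z s o := by
    rw [ENNReal.tsum_comm]; exact tsum_flow G z o ho s
  have e4 : ∑' x, ∑' y, (if x = o then G.flow z o s x y else 0) =
      G.hitGen z s o * (G.vertexWeight o * G.voltage z o s o) := by
    rw [tsum_eq_single o]
    · simp only [if_true]
      rw [tsum_flow_left, discount, if_neg ho, mul_comm]
    · intro x hx
      simp [hx]
  have e5 : ∑' x, ∑' y, (if y = o then G.flow z o s y x else 0) =
      G.hitGen z s o * (G.vertexWeight o * G.voltage z o s o) := by
    rw [ENNReal.tsum_comm]; exact e4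
  have e6 : ∑' x, ∑' y, z.indicator (fun x => G.weight x y) x = G.setWeight z := by
    rw [setWeight, tsum_subtype z G.vertexWeight]
    refine tsum_congr fun x => ?_
    by_cases hx : x ∈ z <;> simp [hx, vertexWeight]
  have e7 : ∑' x, ∑' y, z.indicator (fun y => G.weight y x) y = G.setWeight z := by
    rw [ENNReal.tsum_comm]; exact e6
  rw [e1, e2, e3, e4, e5, e6, e7, tsum_flow G z o ho, ← hX, ← hY] at hsum
  rw [← two_mul (G.hitGen z s o * (G.vertexWeight o * G.voltage z o s o)), ← mul_assoc,
    ENNReal.inv_mul_cancel two_ne_zero ENNReal.ofNat_ne_top, one_mul] at hsum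
  have hYY : 2 * Y ≠ ∞ := ENNReal.mul_ne_top ENNReal.ofNat_ne_top hYt
  rw [← ENNReal.add_le_add_iff_left hYY]
  calc 2 * Y + (2 * (G.hitGen z s o * ψ o) +
        G.hitGen z s o * (G.vertexWeight o * G.voltage z o s o))
      = 2 * (Y + G.hitGen z s o * ψ o) +
        G.hitGen z s o * (G.vertexWeight o * G.voltage z o s o) := by ring
    _ = X + X + G.hitGen z s o * (G.vertexWeight o * G.voltage z o s o) := by rw [hXY, two_mul]
    _ ≤ _ := hsum
    _ = _ := by ring

/-- Together with `voltage_pos_of_adj` it yields a dichotomy on an edge outside z: either u and v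
are positive at both ends, so that the logarithms are meaningful, or the flow vanishes in both
directions. -/
lemma discount_pos_of_adj (G : WeightedGraph V) (z : Set V) {s : ℝ≥0∞} (hs : s ≠ 0) {x y : V}
    (hx : x ∉ z) (hw : G.weight x y ≠ 0) (hy : G.discount z s y ≠ 0) : G.discount z s x ≠ 0 := by
  intro h
  have h1 := G.vertexWeight_mul_discount z s hx
  rw [h, mul_zero, eq_comm, mul_eq_zero, ENNReal.tsum_eq_zero] at h1
  exact (mul_ne_zero hw hy) ((h1.resolve_left hs) y)

lemma voltage_pos_of_adj (G : WeightedGraph V) (z : Set V) (o : V) {s : ℝ≥0∞} (hs : s ≠ 0) {x y : V}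
    (hx : x ∉ z) (hw : G.weight x y ≠ 0) (hy : G.voltage z o s y ≠ 0) : G.voltage z o s x ≠ 0 := by
  intro h
  have h1 := G.vertexWeight_mul_voltage z o s hx
  rw [h, mul_zero, eq_comm, add_eq_zero, mul_eq_zero, ENNReal.tsum_eq_zero] at h1
  exact (mul_ne_zero hw hy) ((h1.2.resolve_left hs) y)

-- The edge inequality involves differences, so it is proved over ℝ and transferred in a form with
-- only nonnegative terms.
open scoped NNReal in
lemma ofReal_edge_le {a b p q κ δ₁ δ₂ ε i j : ℝ} (ha : 0 ≤ a) (hb : 0 ≤ b) (hp : 0 ≤ p) (hq : 0 ≤ q)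
    (hκ : 0 ≤ κ) (h₁ : 0 ≤ δ₁) (h₂ : 0 ≤ δ₂) (hε : 0 ≤ ε) (hi : 0 ≤ i) (hj : 0 ≤ j)
    (h : a * p + b * q + κ * (δ₁ + δ₂) ≤ a + b + a * q + b * p + ε * (i + j)) :
    ENNReal.ofReal a * ENNReal.ofReal p + ENNReal.ofReal b * ENNReal.ofReal q +
      ENNReal.ofReal κ * (ENNReal.ofReal δ₁ + ENNReal.ofReal δ₂) ≤
    ENNReal.ofReal a + ENNReal.ofReal b + ENNReal.ofReal a * ENNReal.ofReal q +
      ENNReal.ofReal b * ENNReal.ofReal p +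
      ENNReal.ofReal ε * (ENNReal.ofReal i + ENNReal.ofReal j) := by
  lift a to ℝ≥0 using ha
  lift b to ℝ≥0 using hb
  lift p to ℝ≥0 using hp
  lift q to ℝ≥0 using hq
  lift κ to ℝ≥0 using hκ
  lift δ₁ to ℝ≥0 using h₁
  lift δ₂ to ℝ≥0 using h₂
  lift ε to ℝ≥0 using hε
  lift i to ℝ≥0 using hi
  lift j to ℝ≥0 using hj
  simp only [ENNReal.ofReal_coe_nnreal]
  exact_mod_cast h

set_option maxHeartbeats 1000000 in
/-- The conditioned walk from `o` to `z` cannot be faster than the biased walk. -/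
theorem hitGenDeriv_lower (G : WeightedGraph V) (z : Set V) (o : V) (ho : o ∉ z) {n : ℕ}
    (hn : 2 ≤ n) (d : V → ℝ) (hd : ∀ x y, G.weight x y ≠ 0 → |d x - d y| ≤ 1)
    (hdz : ∀ x ∈ z, d x = 0) (hdo : d o = n) {s : ℝ} (hs0 : 0 < s) (hs1 : s < 1) {R γ : ℝ}
    (hR0 : 0 < R) (hR : G.setWeight z ≤ ENNReal.ofReal R * G.vertexWeight o) (hγ : 1 < γ)
    {F : ℝ} (hF0 : 0 < F) (hF : G.hitGen z (ENNReal.ofReal s) o = ENNReal.ofReal F) :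
    F * (slownessIntercept γ * (n - 3 / 2) - slownessSlope γ * Real.log (R / F ^ 2) -
      slownessSlope γ - 2 * slownessSlope γ ^ 2) ≤
      (G.hitGenDeriv z (ENNReal.ofReal s) o).toReal := by
  classical
  set σ := ENNReal.ofReal s with hσ
  have hσ0 : σ ≠ 0 := (ENNReal.ofReal_pos.2 hs0).ne'
  have hσ1 : σ < 1 := by rw [hσ, ← ENNReal.ofReal_one]; exact (ENNReal.ofReal_lt_ofReal_iff one_pos).2 hs1
  set M := slownessIntercept γ with hM
  set c := slownessSlope γ with hc
  have hMpos : 0 < M := slownessIntercept_pos hγ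
  have hcpos : 0 < c := slownessSlope_pos hγ
  set u : V → ℝ := fun x => (G.discount z σ x).toReal with hu
  set v : V → ℝ := fun x => (G.voltage z o σ x).toReal with hv
  have hdt : ∀ x, G.discount z σ x ≠ ∞ := fun x =>
    ((G.discount_le_one z hσ1.le x).trans_lt ENNReal.one_lt_top).ne
  have hvt : ∀ x, G.voltage z o σ x ≠ ∞ := G.voltage_ne_top z o hσ1
  have hu0 : ∀ x, 0 ≤ u x := fun x => ENNReal.toReal_nonneg
  have hv0 : ∀ x, 0 ≤ v x := fun x => ENNReal.toReal_nonneg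
  have hu1 : ∀ x, u x ≤ 1 := fun x => by
    have := ENNReal.toReal_mono ENNReal.one_ne_top (G.discount_le_one z hσ1.le x)
    simpa using this
  have huz : ∀ x ∈ z, u x = 1 := fun x hx => by simp [hu, discount, hx]
  have hvz : ∀ x ∈ z, v x = 0 := fun x hx => by simp [hv, voltage, hx]
  have huo : u o = F := by simp [hu, discount, ho, hF, hF0.le]
  have hupos : ∀ x y, x ∉ z → G.weight x y ≠ 0 → 0 < u y → 0 < u x := fun x y hx hw hy =>
    ENNReal.toReal_pos (G.discount_pos_of_adj z hσ0 hx hw fun h => by simp [hu, h] at hy) (hdt x)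
  have hvpos : ∀ x y, x ∉ z → G.weight x y ≠ 0 → 0 < v y → 0 < v x := fun x y hx hw hy =>
    ENNReal.toReal_pos (G.voltage_pos_of_adj z o hσ0 hx hw fun h => by simp [hv, h] at hy) (hvt x)
  set q := (G.vertexWeight o).toReal with hq
  have hqpos : 0 < q := ENNReal.toReal_pos (G.vertexWeight_ne_zero o) (G.vertexWeight_ne_top o)
  have hq' : G.vertexWeight o = ENNReal.ofReal q :=
    (ENNReal.ofReal_toReal (G.vertexWeight_ne_top o)).symm
  have hvo : 0 < v o := by
    refine ENNReal.toReal_pos (fun h => ?_) (hvt o)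
    have h1 := G.vertexWeight_mul_voltage z o σ ho
    rw [h, mul_zero, eq_comm, add_eq_zero] at h1
    simp at h1
  -- W is chosen so that the total error on the edges at z, at most (c / W) w_z ≤ (c / W) R q,
  -- equals c F.
  set W := R * q / F with hW
  have hWpos : 0 < W := by positivity
  -- At o the multiple of the distance is lowered by M / 2; this frees half of the flow leaving o.
  -- The constant M + c log W makes the potential nearly nonpositive next to z.
  set t : V → ℝ := fun x => (if x = o then M * (n - 1 / 2) else M * d x) - c * Real.log (v x / u x) -
    (M + c * Real.log W) with ht
  set B := max (t o) 0 with hB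
  have hB0 : 0 ≤ B := le_max_right _ _
  set ψ : V → ℝ := fun x => if x ∈ z then 0 else min (max (t x) 0) B with hψ
  have hψ0 : ∀ x, 0 ≤ ψ x := fun x => by
    simp only [hψ]; split_ifs
    exacts [le_rfl, le_min (le_max_right _ _) hB0]
  have hψo : ψ o = B := by simp [hψ, ho, hB]
  have hψB : ∀ x, ψ x ≤ B := fun x => by
    simp only [hψ]; split_ifs
    exacts [hB0, min_le_right _ _]
  have hψz : ∀ x ∈ z, ψ x = 0 := fun x hx => by simp [hψ, hx]
  have hψn : ∀ x, x ∉ z → ψ x = min (max (t x) 0) B := fun x hx => by simp [hψ, hx]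
  have hn' : (2 : ℝ) ≤ n := by exact_mod_cast hn
  set ε := c / W with hε
  have hε0 : 0 ≤ ε := by positivity
  -- an edge entering `z`
  have key₁ : ∀ x y, G.weight x y ≠ 0 → x ∉ z → y ∈ z → x ≠ o ∧ v x * ψ x ≤ v x + ε := by
    intro x y hw hx hy
    have hd1 := hd x y hw
    rw [hdz y hy, sub_zero] at hd1
    -- Neighbours of z have d ≤ 1, whereas d o = n ≥ 2.
    have hxo : x ≠ o := by
      rintro rfl
      rw [hdo] at hd1
      have := (abs_le.1 hd1).2
      linarith
    refine ⟨hxo, ?_⟩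
    have hux : 0 < u x := hupos x y hx hw (by rw [huz y hy]; exact one_pos)
    rcases (hv0 x).eq_or_lt with h0 | h0
    · rw [← h0]; simpa using hε0
    -- Next to z one has d ≤ 1, so the potential is at most c log(u / (v W)) ≤ c / (v W): when v is
    -- small the potential may be large, but v ψ stays below ε.
    have h1 : ψ x ≤ ε / v x := by
      rw [hψn x hx]
      refine (min_le_left _ _).trans (max_le ?_ (by positivity))
      simp only [ht, if_neg hxo]
      have h2 : Real.log (u x / (v x * W)) = - Real.log (v x / u x) - Real.log W := by
        rw [Real.log_div hux.ne' (by positivity), Real.log_mul h0.ne' hWpos.ne',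
          Real.log_div h0.ne' hux.ne']
        ring
      have h3 : Real.log (u x / (v x * W)) ≤ 1 / (v x * W) := by
        refine (Real.log_le_self (by positivity)).trans ?_
        gcongr
        exact hu1 x
      have h4 := mul_le_mul_of_nonneg_left h3 hcpos.le
      have h5 := mul_le_mul_of_nonneg_left (abs_le.1 hd1).2 hMpos.le
      have h6 : ε / v x = c * (1 / (v x * W)) := by
        rw [hε]; field_simp
      rw [h6]
      rw [h2] at h4
      linarith
    have h7 := mul_le_mul_of_nonneg_left h1 h0.le
    rw [mul_div_cancel₀ _ h0.ne'] at h7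
    linarith
  -- an edge outside `z`
  have key₂ : ∀ x y, G.weight x y ≠ 0 → x ∉ z → y ∉ z → 0 < v x → 0 < u x → 0 < v y → 0 < u y →
      y ≠ o → (v x * u y - v y * u x) * (ψ x - ψ y) + (if x = o then v x * u y / 2 else 0) ≤
        v x * u y + v y * u x := by
    intro x y hw hx hy hvx hux hvy huy hyo
    have hd1 := abs_le.1 (hd x y hw)
    have hl : Real.log ((v x * u y) / (v y * u x)) = Real.log (v x / u x) - Real.log (v y / u y) := by
      rw [Real.log_div (by positivity) (by positivity), Real.log_div (by positivity) (by positivity),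
        Real.log_div (by positivity) (by positivity), Real.log_mul (by positivity) (by positivity),
        Real.log_mul (by positivity) (by positivity)]
      ring
    have hl' : Real.log ((v y * u x) / (v x * u y)) = Real.log (v y / u y) - Real.log (v x / u x) := by
      rw [← inv_div, Real.log_inv, hl]; ring
    by_cases hxo : x = o
    · subst hxo
      rw [if_pos rfl, hψn x hx, hψn y hy, hB]
      refine sub_mul_clamp_top_le hγ (by positivity) (by positivity) ?_
      rw [hl]
      simp only [ht, if_true, if_neg hyo]
      have h5 := mul_le_mul_of_nonneg_left (show (n : ℝ) - 1 ≤ d y by linarith) hMpos.le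
      nlinarith
    · rw [if_neg hxo, hψn x hx, hψn y hy, add_zero]
      refine sub_mul_clamp_le hγ (by positivity) (by positivity) ?_ ?_
      · rw [hl]
        simp only [ht, if_neg hyo, if_neg hxo]
        have h5 := mul_le_mul_of_nonneg_left hd1.2 hMpos.le
        nlinarith
      · rw [hl']
        simp only [ht, if_neg hyo, if_neg hxo]
        have h5 := mul_le_mul_of_nonneg_left hd1.1 hMpos.le
        nlinarith
  have key : ∀ x y, G.weight x y ≠ 0 →
      v x * u y * ψ x + v y * u x * ψ y +
        2⁻¹ * ((if x = o then v x * u y else 0) + (if y = o then v y * u x else 0)) ≤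
      v x * u y + v y * u x + v x * u y * ψ y + v y * u x * ψ x +
        ε * ((if y ∈ z then 1 else 0) + (if x ∈ z then 1 else 0)) := by
    intro x y hw
    have hw' : G.weight y x ≠ 0 := by rwa [G.symm]
    by_cases hx : x ∈ z <;> by_cases hy : y ∈ z
    · have h1 : x ≠ o := fun h => ho (h ▸ hx)
      have h2 : y ≠ o := fun h => ho (h ▸ hy)
      simp [hvz x hx, hvz y hy, hx, hy, h1, h2]
      linarith
    · obtain ⟨h2, h3⟩ := key₁ y x hw' hy hx
      have h1 : x ≠ o := fun h => ho (h ▸ hx)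
      simp [hvz x hx, huz x hx, hψz x hx, hx, hy, h1, h2]
      linarith
    · obtain ⟨h2, h3⟩ := key₁ x y hw hx hy
      have h1 : y ≠ o := fun h => ho (h ▸ hy)
      simp [hvz y hy, huz y hy, hψz y hy, hx, hy, h1, h2]
      linarith
    · simp only [hx, hy, if_false, add_zero, mul_zero]
      by_cases hpos : 0 < v x ∧ 0 < u x
      · obtain ⟨hvx, hux⟩ := hpos
        have hvy := hvpos y x hy hw' hvx
        have huy := hupos y x hy hw' hux
        by_cases hyo : y = o
        · by_cases hxo : x = o
          · subst hxo; subst hyo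
            simp only [if_true]
            have := mul_pos hvx hux
            linarith
          · have := key₂ y x hw' hy hx hvy huy hvx hux hxo
            rw [if_pos hyo] at this
            rw [if_neg hxo, if_pos hyo]
            linarith
        · have := key₂ x y hw hx hy hvx hux hvy huy hyo
          rw [if_neg hyo]
          split_ifs at this ⊢ <;> linarith
      · have h1 : v x * u y = 0 := by
          by_contra h
          exact hpos ⟨(hv0 x).lt_of_ne' (left_ne_zero_of_mul h),
            hupos x y hx hw ((hu0 y).lt_of_ne' (right_ne_zero_of_mul h))⟩
        have h2 : v y * u x = 0 := by
          by_contra h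
          exact hpos ⟨hvpos x y hx hw ((hv0 y).lt_of_ne' (left_ne_zero_of_mul h)),
            (hu0 x).lt_of_ne' (right_ne_zero_of_mul h)⟩
        simp [h1, h2]
  have hbound := hitGenDeriv_bound G z o ho hσ1 (fun x => ENNReal.ofReal (ψ x))
    (fun x hx => by simp [hψz x hx]) (fun x => ENNReal.ofReal_le_ofReal (by rw [hψo]; exact hψB x))
    ENNReal.ofReal_ne_top (ENNReal.ofReal ε) ?_
  · set F₁ := (G.hitGenDeriv z σ o).toReal with hF₁
    have hF₁' : G.hitGenDeriv z σ o = ENNReal.ofReal F₁ :=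
      (ENNReal.ofReal_toReal (G.hitGenDeriv_ne_top z o ho hσ1)).symm
    have hF₁0 : 0 ≤ F₁ := ENNReal.toReal_nonneg
    have hv' : G.voltage z o σ o = ENNReal.ofReal (v o) := (ENNReal.ofReal_toReal (hvt o)).symm
    have h1 : 2 * (F * B) + F * (q * v o) ≤ 2 * F₁ + 2 * (ε * (R * q)) := by
      rw [← ENNReal.ofReal_le_ofReal_iff (by positivity)]
      refine le_trans (le_of_eq ?_) (hbound.trans ((add_le_add_right (mul_le_mul_right
        (mul_le_mul_right hR _) _) _).trans (le_of_eq ?_)))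
      · rw [hF, hq', hv', hψo, ENNReal.ofReal_add (by positivity) (by positivity),
          ENNReal.ofReal_mul (by positivity), ENNReal.ofReal_mul (by positivity),
          ENNReal.ofReal_mul (by positivity), ENNReal.ofReal_mul (by positivity)]
        simp
      · rw [hF₁', hq', ENNReal.ofReal_add (by positivity) (by positivity),
          ENNReal.ofReal_mul (by positivity), ENNReal.ofReal_mul (by positivity),
          ENNReal.ofReal_mul (by positivity), ENNReal.ofReal_mul (by positivity)]
        simp
    have h2 : ε * (R * q) = c * F := by
      rw [hε, hW]; field_simp
    have h3 : Real.log (v o / u o) + Real.log W = Real.log (R / F ^ 2) + Real.log (q * v o) := by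
      rw [huo, ← Real.log_mul (by positivity) (by positivity),
        ← Real.log_mul (by positivity) (by positivity), hW]
      congr 1
      field_simp
    have h4 := mul_log_le_half_add hcpos (show 0 < q * v o by positivity)
    have h5 : t o ≤ B := le_max_left _ _
    simp only [ht, if_true] at h5
    -- The 3/2 is the sum of the 1/2 removed at o and the 1 in the normalising constant near z.
    have h6 : M * (n - 3 / 2) - c * Real.log (R / F ^ 2) - 2 * c ^ 2 ≤ B + q * v o / 2 := by
      have h7 : c * (Real.log (v o / u o) + Real.log W) =
        c * (Real.log (R / F ^ 2) + Real.log (q * v o)) := by rw [h3]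
      linarith
    have h8 := mul_le_mul_of_nonneg_left h6 hF0.le
    rw [h2] at h1
    linarith
  · intro x y
    rcases eq_or_ne (G.weight x y) 0 with hw | hw
    · have hw' : G.weight y x = 0 := by rwa [G.symm]
      simp [flow, hw, hw']
    set w := (G.weight x y).toReal with hwr
    have hw1 : G.weight x y = ENNReal.ofReal w := (ENNReal.ofReal_toReal (G.weight_ne_top x y)).symm
    have hw2 : G.weight y x = ENNReal.ofReal w := by rw [G.symm, hw1]
    have hw0 : 0 ≤ w := ENNReal.toReal_nonneg
    have hu' : ∀ x, G.discount z σ x = ENNReal.ofReal (u x) := fun x =>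
      (ENNReal.ofReal_toReal (hdt x)).symm
    have hv' : ∀ x, G.voltage z o σ x = ENNReal.ofReal (v x) := fun x =>
      (ENNReal.ofReal_toReal (hvt x)).symm
    have hf1 : G.flow z o σ x y = ENNReal.ofReal (s * w * (v x * u y)) := by
      rw [flow, hw1, hu', hv', ENNReal.ofReal_mul (by positivity), ENNReal.ofReal_mul (by positivity),
        ENNReal.ofReal_mul (hv0 x), mul_assoc (σ * _)]
    have hf2 : G.flow z o σ y x = ENNReal.ofReal (s * w * (v y * u x)) := by
      rw [flow, hw2, hu', hv', ENNReal.ofReal_mul (by positivity), ENNReal.ofReal_mul (by positivity),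
        ENNReal.ofReal_mul (hv0 y), mul_assoc (σ * _)]
    have hi1 : z.indicator (fun y => G.weight y x) y = ENNReal.ofReal (if y ∈ z then w else 0) := by
      by_cases h : y ∈ z <;> simp [h, hw2]
    have hi2 : z.indicator (fun x => G.weight x y) x = ENNReal.ofReal (if x ∈ z then w else 0) := by
      by_cases h : x ∈ z <;> simp [h, hw1]
    have ho1 : (if x = o then ENNReal.ofReal (s * w * (v x * u y)) else 0) =
        ENNReal.ofReal (if x = o then s * w * (v x * u y) else 0) := by
      split_ifs <;> simp
    have ho2 : (if y = o then ENNReal.ofReal (s * w * (v y * u x)) else 0) =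
        ENNReal.ofReal (if y = o then s * w * (v y * u x) else 0) := by
      split_ifs <;> simp
    have hhalf : (2⁻¹ : ℝ≥0∞) = ENNReal.ofReal 2⁻¹ := by
      rw [ENNReal.ofReal_inv_of_pos two_pos]; simp
    have n1 : 0 ≤ s * w * (v x * u y) :=
      mul_nonneg (by positivity) (mul_nonneg (hv0 x) (hu0 y))
    have n2 : 0 ≤ s * w * (v y * u x) :=
      mul_nonneg (by positivity) (mul_nonneg (hv0 y) (hu0 x))
    rw [hf1, hf2, hi1, hi2, ho1, ho2, hhalf]
    refine ofReal_edge_le n1 n2 (hψ0 x) (hψ0 y) (by positivity) (by split_ifs <;> simp [n1])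
      (by split_ifs <;> simp [n2]) hε0 (by split_ifs <;> simp [hw0]) (by split_ifs <;> simp [hw0]) ?_
    have h1 := mul_le_mul_of_nonneg_left (key x y hw) (show 0 ≤ s * w by positivity)
    -- The flows carry a factor s but the error term at z does not, so the latter is enlarged from s
    -- ε w to ε w.
    have h2 : 0 ≤ (1 - s) * (ε * w) := mul_nonneg (by linarith) (by positivity)
    have h3 : 0 ≤ ((if y ∈ z then 1 else 0) + (if x ∈ z then 1 else 0) : ℝ) := by
      split_ifs <;> norm_num
    have h4 := mul_nonneg h2 h3
    split_ifs at h1 h4 ⊢ <;> linarith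

end WeightedGraph

/-! ### The biased walk as solution of the comparison equation -/

/-- The logarithm of the discount factor at which the biased walk has `E s^T' = exp L`. -/
def logDiscount (g L : ℝ) : ℝ := Real.log (g + 1) + L - Real.log (g + Real.exp (2 * L))

lemma logDiscount_zero (g : ℝ) : logDiscount g 0 = 0 := by simp [logDiscount]

lemma biasedSlowness_mul_exp {g L : ℝ} :
    (biasedSlowness (g * Real.exp (-(2 * L))))⁻¹ =
      (g - Real.exp (2 * L)) / (g + Real.exp (2 * L)) := by
  have h : g * Real.exp (-(2 * L)) = g / Real.exp (2 * L) := by rw [Real.exp_neg]; rfl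
  have := Real.exp_pos (2 * L)
  rw [biasedSlowness, h, inv_div]
  rw [div_sub_one this.ne', div_add_one this.ne', div_div_div_cancel_right₀ this.ne']

/-- The biased walk reweighted by s^T' has odds 1 and g e^(-2L), hence slowness m(g e^(-2L)). This
slowness is dL/dσ, and `logDiscount` is the inverse function. -/
lemma hasDerivAt_logDiscount {g : ℝ} (hg : 0 < g) (L : ℝ) :
    HasDerivAt (logDiscount g) (biasedSlowness (g * Real.exp (-(2 * L))))⁻¹ L := by
  have hpos : 0 < g + Real.exp (2 * L) := by positivity
  have h1 : HasDerivAt (fun L => Real.exp (2 * L)) (Real.exp (2 * L) * 2) L := by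
    simpa using ((hasDerivAt_id L).const_mul 2).exp
  have h2 := ((hasDerivAt_id L).const_add (Real.log (g + 1))).sub ((h1.const_add g).log hpos.ne')
  refine h2.congr_deriv ?_
  rw [biasedSlowness_mul_exp]
  field_simp
  ring

lemma le_mul_exp_neg {g L : ℝ} (hg : 0 < g) (hL : L ≤ 0) : g ≤ g * Real.exp (-(2 * L)) :=
  le_mul_of_one_le_right hg.le (Real.one_le_exp (by linarith))

lemma strictMonoOn_logDiscount {g : ℝ} (hg : 1 < g) :
    StrictMonoOn (logDiscount g) (Set.Iic 0) := by
  refine strictMonoOn_of_deriv_pos (convex_Iic 0) ?_ ?_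
  · exact fun L _ => (hasDerivAt_logDiscount (by linarith) L).continuousAt.continuousWithinAt
  · intro L hL
    rw [interior_Iic] at hL
    rw [(hasDerivAt_logDiscount (by linarith) L).deriv]
    have := one_le_biasedSlowness (hg.trans_le (le_mul_exp_neg (by linarith) (le_of_lt hL)))
    positivity

lemma logDiscount_neg {g L : ℝ} (hg : 1 < g) (hL : L < 0) : logDiscount g L < 0 := by
  rw [← logDiscount_zero g]
  exact strictMonoOn_logDiscount hg hL.le (Set.mem_Iic.2 le_rfl) hL

/-- The loss in the number of steps of the comparison with the biased walk. -/
def stepLoss (C g : ℝ) : ℝ :=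
  3 / 2 * (biasedSlowness g + 2 * g / (g - 1)) +
    slownessSlope g * (Real.log C + 1 + 2 * slownessSlope g)

lemma stepLoss_nonneg {C g : ℝ} (hC : 1 < C) (hg : 1 < g) : 0 ≤ stepLoss C g := by
  have h1 := one_le_biasedSlowness hg
  have h2 := slownessSlope_pos hg
  have h3 := Real.log_pos hC
  have h4 : 0 < g - 1 := by linarith
  unfold stepLoss
  positivity

lemma biasedSlowness_anti {g γ : ℝ} (hg : 1 < g) (h : g ≤ γ) :
    biasedSlowness γ ≤ biasedSlowness g := by
  unfold biasedSlowness
  rw [div_le_div_iff₀ (by linarith) (by linarith)]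
  nlinarith

lemma slownessSlope_anti {g γ : ℝ} (hg : 1 < g) (h : g ≤ γ) :
    slownessSlope γ ≤ slownessSlope g := by
  have h1 : 0 < g - 1 := by linarith
  have h2 : 0 < γ - 1 := by linarith
  unfold slownessSlope
  rw [div_le_div_iff₀ (by positivity) (by positivity)]
  have : g * (γ - 1) ^ 2 - γ * (g - 1) ^ 2 = (γ - g) * (γ * g - 1) := by ring
  have h3 : 0 ≤ (γ - g) * (γ * g - 1) := mul_nonneg (by linarith) (by nlinarith)
  linarith

lemma slownessIntercept_le {g γ : ℝ} (hg : 1 < g) (h : g ≤ γ) :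
    slownessIntercept γ ≤ biasedSlowness g + 2 * g / (g - 1) := by
  have h1 : 0 < g - 1 := by linarith
  have h2 : 0 < γ - 1 := by linarith
  have h3 : slownessSlope γ * Real.log γ ≤ slownessSlope γ * (γ - 1) :=
    mul_le_mul_of_nonneg_left (Real.log_le_sub_one_of_pos (by linarith))
      (slownessSlope_pos (by linarith)).le
  have h4 : slownessSlope γ * (γ - 1) = 2 * γ / (γ - 1) := by
    unfold slownessSlope; field_simp
  have h5 : 2 * γ / (γ - 1) ≤ 2 * g / (g - 1) := by
    rw [div_le_div_iff₀ h2 h1]; nlinarith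
  have := biasedSlowness_anti hg h
  unfold slownessIntercept
  linarith

/-- The right side is the lower bound of `hitGenDeriv_lower` with log(R/F²) = log C + n log γ. The
terms in n log γ cancel, leaving n m(γ); the rest is bounded uniformly in γ ≥ g, and since m(γ) ≥ 1
it can be charged to the number of steps. -/
lemma biasedSlowness_mul_le {C g γ : ℝ} (hC : 1 < C) (hg : 1 < g) (h : g ≤ γ) (n : ℝ) :
    biasedSlowness γ * (n - stepLoss C g) ≤ slownessIntercept γ * (n - 3 / 2) -
      slownessSlope γ * (Real.log C + n * Real.log γ) - slownessSlope γ -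
        2 * slownessSlope γ ^ 2 := by
  have h1 := slownessIntercept_le hg h
  have h2 := slownessSlope_anti hg h
  have h3 := Real.log_pos hC
  have h0 := slownessSlope_pos (hg.trans_le h)
  have hg0 := slownessSlope_pos hg
  have h4 : slownessSlope γ * (Real.log C + 1 + 2 * slownessSlope γ) ≤
      slownessSlope g * (Real.log C + 1 + 2 * slownessSlope g) := by gcongr
  have h5 : stepLoss C g ≤ biasedSlowness γ * stepLoss C g :=
    le_mul_of_one_le_left (stepLoss_nonneg hC hg) (one_le_biasedSlowness (hg.trans_le h))
  have h6 : slownessIntercept γ * n = biasedSlowness γ * n + slownessSlope γ * (n * Real.log γ) := by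
    unfold slownessIntercept; ring
  have h7 : stepLoss C g = 3 / 2 * (biasedSlowness g + 2 * g / (g - 1)) +
    slownessSlope g * (Real.log C + 1 + 2 * slownessSlope g) := rfl
  linarith

/-- The comparison principle for the logarithmic derivative of a generating function. -/
lemma logDiscount_le_of_deriv {g n K : ℝ} (hg : 1 < g) (hn : 0 < n) {F F' : ℝ → ℝ}
    (hF : ∀ σ < 0, HasDerivAt F (F' σ) σ) (hpos : ∀ σ < 0, 0 < F σ) (hle : ∀ σ < 0, F σ ≤ 1)
    (hF' : ∀ σ < 0, F σ * (biasedSlowness (g * Real.exp (-(2 * (Real.log (F σ) / n)))) * (n - K)) ≤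
      F' σ) {σ : ℝ} (hσ : σ < 0) :
    logDiscount g (Real.log (F σ) / n) ≤ (1 - K / n) * σ := by
  have hL : ∀ σ < 0, Real.log (F σ) / n ≤ 0 := fun σ hσ =>
    div_nonpos_of_nonpos_of_nonneg (Real.log_nonpos (hpos σ hσ).le (hle σ hσ)) hn.le
  set h : ℝ → ℝ := fun σ => logDiscount g (Real.log (F σ) / n) - (1 - K / n) * σ with hh
  have hd : ∀ σ < 0, HasDerivAt h
      ((biasedSlowness (g * Real.exp (-(2 * (Real.log (F σ) / n)))))⁻¹ * (F' σ / F σ / n) -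
        (1 - K / n)) σ := by
    intro σ hσ
    have h1 := (hasDerivAt_logDiscount (g := g) (by linarith) (Real.log (F σ) / n)).comp σ
      (((hF σ hσ).log (hpos σ hσ).ne').div_const n)
    have h2 := h1.sub ((hasDerivAt_id σ).const_mul (1 - K / n))
    exact h2.congr_deriv (by rw [mul_one])
  have hmono : MonotoneOn h (Set.Iio 0) := by
    refine monotoneOn_of_deriv_nonneg (convex_Iio 0) ?_ ?_ ?_
    · exact fun τ hτ => (hd τ hτ).continuousAt.continuousWithinAt
    · intro τ hτ
      rw [interior_Iio] at hτ
      exact (hd τ hτ).differentiableAt.differentiableWithinAt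
    · intro τ hτ
      rw [interior_Iio] at hτ
      rw [(hd τ hτ).deriv]
      have h0 := hpos τ hτ
      have h1 := hF' τ hτ
      set m := biasedSlowness (g * Real.exp (-(2 * (Real.log (F τ) / n))))
      have hm : 1 ≤ m := one_le_biasedSlowness (hg.trans_le (le_mul_exp_neg (by linarith) (hL τ hτ)))
      have h2 : 1 - K / n = m⁻¹ * (F τ * (m * (n - K)) / F τ / n) := by
        field_simp
      rw [h2, sub_nonneg]
      gcongr
  -- Only F ≤ 1 is needed near σ = 0, not F → 1, so T may be infinite with positive probability.
  have hlim : Tendsto (fun τ : ℝ => -((1 - K / n) * τ)) (nhdsWithin 0 (Set.Iio 0)) (nhds 0) := by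
    have : Continuous fun τ : ℝ => -((1 - K / n) * τ) := by fun_prop
    have h1 := this.tendsto 0
    simp only [mul_zero, neg_zero] at h1
    exact h1.mono_left nhdsWithin_le_nhds
  have h2 : h σ ≤ 0 := by
    refine ge_of_tendsto hlim ?_
    filter_upwards [Ioo_mem_nhdsLT hσ] with τ hτ
    have h3 := hmono hσ hτ.2 hτ.1.le
    have h4 : logDiscount g (Real.log (F τ) / n) ≤ 0 := by
      rw [← logDiscount_zero g]
      exact (strictMonoOn_logDiscount hg).monotoneOn (hL τ hτ.2) (Set.mem_Iic.2 le_rfl) (hL τ hτ.2)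
    refine h3.trans ?_
    simp only [hh]
    linarith
  simp only [hh] at h2
  linarith

lemma summable_succ_mul_exp {σ : ℝ} (hσ : σ < 0) :
    Summable fun k : ℕ => ((k : ℝ) + 1) * Real.exp ((k + 1) * σ) := by
  have h := summable_pow_mul_geometric_of_norm_lt_one (R := ℝ) 1
    (r := Real.exp σ) (by rw [Real.norm_of_nonneg (Real.exp_pos σ).le]; exact (Real.exp_lt_exp.2 hσ).trans_eq Real.exp_zero)
  have h1 := (summable_nat_add_iff 1).2 h
  refine h1.congr fun k => ?_
  rw [← Real.exp_nat_mul]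
  push_cast
  ring

lemma summable_exp_mul {p : ℕ → ℝ} (hp0 : ∀ k, 0 ≤ p k) (hp1 : ∀ k, p k ≤ 1) {σ : ℝ}
    (hσ : σ < 0) : Summable fun k : ℕ => Real.exp ((k + 1) * σ) * p k := by
  refine Summable.of_nonneg_of_le (fun k => mul_nonneg (by positivity) (hp0 k)) (fun k => ?_)
    (summable_succ_mul_exp hσ)
  rw [mul_comm]
  exact mul_le_mul_of_nonneg_right ((hp1 k).trans (by simp)) (by positivity)

lemma hasDerivAt_tsum_exp {p : ℕ → ℝ} (hp0 : ∀ k, 0 ≤ p k) (hp1 : ∀ k, p k ≤ 1) {σ : ℝ}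
    (hσ : σ < 0) :
    HasDerivAt (fun σ => ∑' k : ℕ, Real.exp ((k + 1) * σ) * p k)
      (∑' k : ℕ, (k + 1) * (Real.exp ((k + 1) * σ) * p k)) σ := by
  -- On the half-line below σ / 2 the differentiated series is dominated by its value at σ / 2 with
  -- all p k replaced by 1.
  have hs := summable_succ_mul_exp (σ := σ / 2) (by linarith)
  refine hasDerivAt_tsum_of_isPreconnected
    (g := fun (k : ℕ) (y : ℝ) => Real.exp ((k + 1) * y) * p k)
    (g' := fun (k : ℕ) (y : ℝ) => (k + 1) * (Real.exp ((k + 1) * y) * p k)) hs (isOpen_Iio (a := σ / 2))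
    (convex_Iio (σ / 2)).isPreconnected (y₀ := σ) ?_ ?_ ?_ ?_ ?_
  · intro k y _
    have h1 : HasDerivAt (fun σ => Real.exp (((k : ℝ) + 1) * σ)) (Real.exp ((k + 1) * y) * (k + 1)) y := by
      simpa using ((hasDerivAt_id y).const_mul ((k : ℝ) + 1)).exp
    exact (h1.mul_const (p k)).congr_deriv (by ring)
  · intro k y hy
    have h2 : 0 ≤ p k := hp0 k
    rw [Real.norm_of_nonneg (by positivity)]
    have h3 : Real.exp (((k : ℝ) + 1) * y) ≤ Real.exp ((k + 1) * (σ / 2)) :=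
      Real.exp_le_exp.2 (mul_le_mul_of_nonneg_left (le_of_lt hy) (by positivity))
    have h4 : Real.exp (((k : ℝ) + 1) * y) * p k ≤ Real.exp ((k + 1) * (σ / 2)) * 1 :=
      mul_le_mul h3 (hp1 k) h2 (by positivity)
    have := mul_le_mul_of_nonneg_left h4 (show (0 : ℝ) ≤ k + 1 by positivity)
    simpa using this
  · simp; linarith
  · exact summable_exp_mul hp0 hp1 hσ
  · simp; linarith

/-! ### Comparison of an arbitrary admissible graph with the biased walk -/

namespace WeightedGraph

variable {V : Type u}

lemma Admissible.notMem {C g : ℝ} {n : ℕ} {G : WeightedGraph V} {o : V} {z : Set V}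
    (h : Admissible C g n G o z) (hn : 1 ≤ n) : o ∉ z := by
  intro ho
  have h1 : G.distToSet o z ≤ 0 := (iInf₂_le o ho).trans (by simp)
  have h2 := h.1.trans h1
  norm_cast at h2
  omega

/-- The function is the distance to z truncated at n: truncation makes it finite everywhere and
equal to n at o, and preserves the Lipschitz bound. -/
lemma exists_dist (G : WeightedGraph V) {n : ℕ} {o : V} {z : Set V}
    (h : (n : ℕ∞) ≤ G.distToSet o z) :
    ∃ d : V → ℝ, (∀ x y, G.weight x y ≠ 0 → |d x - d y| ≤ 1) ∧ (∀ x ∈ z, d x = 0) ∧ d o = n := by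
  have hstep : ∀ x y, G.weight x y ≠ 0 → G.distToSet x z ≤ G.distToSet y z + 1 := by
    intro x y hw
    rcases eq_or_ne x y with rfl | hxy
    · exact le_self_add
    have hadj : G.toSimpleGraph.Adj x y := ⟨hxy, hw⟩
    have h1 : G.toSimpleGraph.edist x y ≤ 1 := (SimpleGraph.edist_eq_one_iff_adj.2 hadj).le
    unfold distToSet
    rw [ENat.iInf_add]
    refine le_iInf fun p => ?_
    rw [ENat.iInf_add]
    refine le_iInf fun hp => (iInf₂_le p hp).trans ?_
    rw [add_comm]
    exact SimpleGraph.edist_triangle.trans (add_le_add_left h1 _)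
  set D : V → ℕ := fun x => (min (G.distToSet x z) n).toNat with hD
  have hDle : ∀ x y, G.weight x y ≠ 0 → D x ≤ D y + 1 := by
    intro x y hw
    have h1 : min (G.distToSet x z) n ≤ min (G.distToSet y z) n + 1 := by
      rcases le_total (G.distToSet y z) n with h2 | h2
      · rw [min_eq_left h2]
        exact (min_le_left _ _).trans (hstep x y hw)
      · rw [min_eq_right h2]
        exact (min_le_right _ _).trans le_self_add
    have hne : ∀ x, min (G.distToSet x z) n ≠ ⊤ := fun x =>
      ((min_le_right _ _).trans_lt (ENat.natCast_lt_top n)).ne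
    rw [← ENat.natCast_toNat (hne x), ← ENat.natCast_toNat (hne y)] at h1
    exact_mod_cast h1
  refine ⟨fun x => D x, fun x y hw => ?_, fun x hx => ?_, ?_⟩
  · have h1 := hDle x y hw
    have h2 := hDle y x (by rwa [G.symm])
    rw [abs_le]
    constructor
    · have : (D y : ℝ) ≤ D x + 1 := by exact_mod_cast h2
      linarith
    · have : (D x : ℝ) ≤ D y + 1 := by exact_mod_cast h1
      linarith
  · have h1 : G.distToSet x z = 0 := le_antisymm ((iInf₂_le x hx).trans (by simp)) zero_le
    simp [hD, h1]
  · simp [hD, h]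

lemma hitProb_ne_top (G : WeightedGraph V) (z : Set V) (k : ℕ) (o : V) : G.hitProb z k o ≠ ∞ :=
  (((ENNReal.le_tsum k).trans (G.tsum_hitProb_le z o)).trans_lt ENNReal.one_lt_top).ne

lemma toReal_hitProb_le_one (G : WeightedGraph V) (z : Set V) (k : ℕ) (o : V) :
    (G.hitProb z k o).toReal ≤ 1 := by
  simpa using ENNReal.toReal_mono ENNReal.one_ne_top
    ((ENNReal.le_tsum k).trans (G.tsum_hitProb_le z o))

lemma ofReal_exp_mul_hitProb (G : WeightedGraph V) (z : Set V) (k : ℕ) (o : V) (σ : ℝ) :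
    ENNReal.ofReal (Real.exp σ) ^ (k + 1) * G.hitProb z k o =
      ENNReal.ofReal (Real.exp ((k + 1) * σ) * (G.hitProb z k o).toReal) := by
  rw [ENNReal.ofReal_mul (Real.exp_pos _).le, ENNReal.ofReal_toReal (G.hitProb_ne_top z k o),
    ← ENNReal.ofReal_pow (Real.exp_pos _).le, ← Real.exp_nat_mul]
  push_cast
  rfl

/-- The generating function of the hitting time, as a real function of the logarithm. -/
lemma hitGen_ofReal_exp (G : WeightedGraph V) (z : Set V) (o : V) (σ : ℝ) (hσ : σ < 0) :
    G.hitGen z (ENNReal.ofReal (Real.exp σ)) o =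
      ENNReal.ofReal (∑' k : ℕ, Real.exp ((k + 1) * σ) * (G.hitProb z k o).toReal) := by
  rw [ENNReal.ofReal_tsum_of_nonneg (fun k => mul_nonneg (Real.exp_pos _).le ENNReal.toReal_nonneg)
    (summable_exp_mul (fun _ => ENNReal.toReal_nonneg) (fun k => G.toReal_hitProb_le_one z k o) hσ)]
  exact tsum_congr fun k => G.ofReal_exp_mul_hitProb z k o σ

lemma toReal_hitGenDeriv (G : WeightedGraph V) (z : Set V) (o : V) (σ : ℝ) :
    (G.hitGenDeriv z (ENNReal.ofReal (Real.exp σ)) o).toReal =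
      ∑' k : ℕ, (k + 1) * (Real.exp ((k + 1) * σ) * (G.hitProb z k o).toReal) := by
  simp_rw [hitGenDeriv, ofReal_exp_mul_hitProb]
  rw [ENNReal.tsum_toReal_eq fun k => ENNReal.mul_ne_top (by finiteness) ENNReal.ofReal_ne_top]
  refine tsum_congr fun k => ?_
  rw [ENNReal.toReal_mul, ENNReal.toReal_ofReal
    (mul_nonneg (Real.exp_pos _).le ENNReal.toReal_nonneg)]
  congr 1

/-- The generating function of the hitting time is at most that of the biased walk, at a
slightly smaller discount. -/
theorem hitGen_le (G : WeightedGraph V) {z : Set V} {o : V} {C g : ℝ} (hC : 1 < C) (hg : 1 < g)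
    {n : ℕ} (hn : 2 ≤ n) (hnK : stepLoss C g < n) (h : Admissible C g n G o z) {L : ℝ} (hL : L < 0) :
    G.hitGen z (ENNReal.ofReal (Real.exp (logDiscount g L / (1 - stepLoss C g / n)))) o ≤
      ENNReal.ofReal (Real.exp (n * L)) := by
  have ho := h.notMem (by omega)
  have hn0 : (0 : ℝ) < n := by positivity
  have hK1 : 0 < 1 - stepLoss C g / n := by rw [sub_pos, div_lt_one hn0]; exact hnK
  set p : ℕ → ℝ := fun k => (G.hitProb z k o).toReal with hp
  have hp0 : ∀ k, 0 ≤ p k := fun k => ENNReal.toReal_nonneg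
  have hp1 : ∀ k, p k ≤ 1 := fun k => G.toReal_hitProb_le_one z k o
  set F : ℝ → ℝ := fun σ => ∑' k : ℕ, Real.exp ((k + 1) * σ) * p k with hF
  have hFgen : ∀ σ < 0, G.hitGen z (ENNReal.ofReal (Real.exp σ)) o = ENNReal.ofReal (F σ) :=
    fun σ hσ => G.hitGen_ofReal_exp z o σ hσ
  have hF0 : ∀ σ, 0 ≤ F σ := fun σ => tsum_nonneg fun k => mul_nonneg (Real.exp_pos _).le (hp0 k)
  set σ := logDiscount g L / (1 - stepLoss C g / n) with hσ
  have hσ0 : σ < 0 := div_neg_of_neg_of_pos (logDiscount_neg hg hL) hK1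
  have hF1 : ∀ σ < 0, F σ ≤ 1 := by
    intro σ hσ
    have h1 := G.hitGen_le_one z (s := ENNReal.ofReal (Real.exp σ))
      (ENNReal.ofReal_le_one.2 (Real.exp_le_one_iff.2 hσ.le)) o
    rw [hFgen σ hσ, ENNReal.ofReal_le_one] at h1
    exact h1
  rw [hFgen σ hσ0]
  refine ENNReal.ofReal_le_ofReal ?_
  -- If z is almost surely never reached, F = 0 has no logarithm, but the bound is trivial.
  by_cases hz : ∀ k, p k = 0
  · simp [hF, hz, (Real.exp_pos _).le]
  push Not at hz
  obtain ⟨k, hk⟩ := hz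
  have hFpos : ∀ σ < 0, 0 < F σ := fun σ hσ =>
    (summable_exp_mul hp0 hp1 hσ).tsum_pos (fun k => mul_nonneg (Real.exp_pos _).le (hp0 k)) k
      (mul_pos (Real.exp_pos _) ((hp0 k).lt_of_ne' hk))
  obtain ⟨d, hd1, hd2, hd3⟩ := G.exists_dist h.1
  have key := logDiscount_le_of_deriv (g := g) (n := n) (K := stepLoss C g) hg hn0
    (fun σ hσ => hasDerivAt_tsum_exp hp0 hp1 hσ) hFpos hF1 ?_ hσ0
  · rw [hσ, mul_div_cancel₀ _ hK1.ne', ← hσ] at key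
    have h1 : Real.log (F σ) / n ≤ 0 :=
      div_nonpos_of_nonpos_of_nonneg (Real.log_nonpos (hF0 σ) (hF1 σ hσ0)) hn0.le
    have h2 : Real.log (F σ) / n ≤ L :=
      ((strictMonoOn_logDiscount hg).le_iff_le h1 (Set.mem_Iic.2 hL.le)).1 key
    rw [div_le_iff₀ hn0] at h2
    rw [← Real.log_le_iff_le_exp (hFpos σ hσ0), mul_comm]
    exact h2
  · intro τ hτ
    -- This γ = g F^(-2/n) turns R / F² = C g^n / F² into C γ^n.
    set γ := g * Real.exp (-(2 * (Real.log (F τ) / n))) with hγ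
    have hgγ : g ≤ γ := le_mul_exp_neg (by linarith) (div_nonpos_of_nonpos_of_nonneg
      (Real.log_nonpos (hF0 τ) (hF1 τ hτ)) hn0.le)
    have hγ1 : 1 < γ := hg.trans_le hgγ
    have hR : G.setWeight z ≤ ENNReal.ofReal (C * g ^ n) * G.vertexWeight o :=
      (ENNReal.div_le_iff (G.vertexWeight_ne_zero o) (G.vertexWeight_ne_top o)).1 h.2
    have h1 := G.hitGenDeriv_lower z o ho hn d hd1 hd2 hd3 (Real.exp_pos τ) ((Real.exp_lt_exp.2 hτ).trans_eq Real.exp_zero)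
      (by positivity) hR hγ1 (hFpos τ hτ) (hFgen τ hτ)
    rw [toReal_hitGenDeriv G z o τ] at h1
    refine le_trans (mul_le_mul_of_nonneg_left ?_ (hF0 τ)) h1
    refine (biasedSlowness_mul_le hC hg hgγ n).trans (le_of_eq ?_)
    have h2 : Real.log (C * g ^ n / F τ ^ 2) = Real.log C + n * Real.log γ := by
      have := hFpos τ hτ
      rw [Real.log_div (by positivity) (by positivity), Real.log_mul (by positivity) (by positivity),
        Real.log_pow, Real.log_pow, hγ, Real.log_mul (by positivity) (by positivity), Real.log_exp]
      field_simp
      push_cast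
      ring
    rw [h2]

/-- The inequality 1 ≤ l t + e^(-lt) is integrated over the law of T; at t = ∞ the first term alone
suffices. -/
lemma one_le_mul_meanHit_add (G : WeightedGraph V) (z : Set V) (o : V) (ho : o ∉ z) {l : ℝ}
    (hl : 0 < l) :
    1 ≤ ENNReal.ofReal l * G.meanHit o z + G.hitGen z (ENNReal.ofReal (Real.exp (-l))) o := by
  rw [meanHit, expectHit_eq G z o ho, hitGen, ← G.missProb_add z o, mul_add, add_assoc,
    ← ENNReal.tsum_mul_left, ← ENNReal.tsum_add]
  refine add_le_add ?_ (ENNReal.tsum_le_tsum fun k => ?_)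
  · rcases eq_or_ne (G.missProb z o) 0 with h | h
    · simp [h]
    · simp [h, ENNReal.top_mul, ENNReal.mul_top, hl]
  · have h1 : (1 : ℝ) ≤ l * (k + 1 : ℕ) + Real.exp (-l) ^ (k + 1) := by
      rw [← Real.exp_nat_mul]
      have := Real.add_one_le_exp (((k + 1 : ℕ) : ℝ) * -l)
      linarith
    have h2 : (1 : ℝ≥0∞) ≤ ENNReal.ofReal l * ((k + 1 : ℕ) : ℝ≥0∞) +
        ENNReal.ofReal (Real.exp (-l)) ^ (k + 1) := by
      rw [← ENNReal.ofReal_natCast, ← ENNReal.ofReal_mul hl.le, ← ENNReal.ofReal_pow (by positivity),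
        ← ENNReal.ofReal_add (by positivity) (by positivity), ← ENNReal.ofReal_one]
      exact ENNReal.ofReal_le_ofReal h1
    calc G.hitProb z k o = 1 * G.hitProb z k o := (one_mul _).symm
      _ ≤ _ := mul_le_mul_left h2 _
      _ = _ := by simp [add_mul, mul_assoc]

/-- A lower bound for the mean from an upper bound of the generating function. -/
lemma le_meanHit (G : WeightedGraph V) (z : Set V) (o : V) (ho : o ∉ z) {g κ ν : ℝ} (hg : 1 < g)
    (hκ : 0 < κ)
    (h : ∀ L < 0, G.hitGen z (ENNReal.ofReal (Real.exp (logDiscount g L * κ))) o ≤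
      ENNReal.ofReal (Real.exp (ν * L))) :
    ENNReal.ofReal (ν * biasedSlowness g / κ) ≤ G.meanHit o z := by
  rcases eq_or_ne (G.meanHit o z) ∞ with htop | htop
  · rw [htop]; exact le_top
  rw [ENNReal.ofReal_le_iff_le_toReal htop]
  set μ := (G.meanHit o z).toReal with hμ
  have hμ' : G.meanHit o z = ENNReal.ofReal μ := (ENNReal.ofReal_toReal htop).symm
  have h1 : ∀ L < 0, (1 - Real.exp (ν * L)) / (-(logDiscount g L * κ)) ≤ μ := by
    intro L hL
    have hl : 0 < -(logDiscount g L * κ) :=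
      neg_pos.2 (mul_neg_of_neg_of_pos (logDiscount_neg hg hL) hκ)
    have h2 := G.one_le_mul_meanHit_add z o ho hl
    rw [neg_neg] at h2
    have h3 := h2.trans (add_le_add_right (h L hL) _)
    rw [hμ', ← ENNReal.ofReal_mul hl.le, ← ENNReal.ofReal_add
      (mul_nonneg hl.le ENNReal.toReal_nonneg) (by positivity), ENNReal.one_le_ofReal] at h3
    rw [div_le_iff₀ hl]
    linarith
  -- Numerator and denominator of the bound vanish at L = 0, so as L → 0⁻ their quotient tends to
  -- the quotient of the derivatives.
  have e0 : biasedSlowness (g * Real.exp (-(2 * 0))) = biasedSlowness g := by simp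
  have hd1 := (hasDerivAt_logDiscount (g := g) (by linarith) 0).tendsto_slope
  have hd2 : HasDerivAt (fun L => Real.exp (ν * L)) ν 0 := by
    simpa using ((hasDerivAt_id (0 : ℝ)).const_mul ν).exp
  have hd2 := hd2.tendsto_slope
  rw [e0] at hd1
  have hm : 0 < biasedSlowness g := by linarith [one_le_biasedSlowness hg]
  have hlim := (hd2.div (hd1.mul_const κ) (by positivity)).mono_left
    (nhdsWithin_mono 0 (fun x hx => ne_of_lt hx) : nhdsWithin 0 (Set.Iio (0 : ℝ)) ≤ _)
  have e1 : ν / ((biasedSlowness g)⁻¹ * κ) = ν * biasedSlowness g / κ := by field_simp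
  rw [e1] at hlim
  refine le_of_tendsto hlim ?_
  filter_upwards [self_mem_nhdsWithin] with L hL
  refine le_trans (le_of_eq ?_) (h1 L hL)
  have hL' : L ≠ 0 := ne_of_lt hL
  have hlL : logDiscount g L ≠ 0 := (logDiscount_neg hg hL).ne
  simp only [Pi.div_apply, slope_def_field, logDiscount_zero, mul_zero, Real.exp_zero, sub_zero]
  field_simp
  ring

end WeightedGraph

/-! ### Binomial probabilities -/

/-- The largest term of the binomial expansion of `(j + l) ^ (j + l)`. -/
lemma pow_le_succ_mul_choose (j l : ℕ) (hl : 0 < l) :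
    (j + l) ^ (j + l) ≤ (j + l + 1) * ((j + l).choose j * (j ^ j * l ^ l)) := by
  set K := j + l with hK
  set t : ℕ → ℕ := fun i => j ^ i * l ^ (K - i) * K.choose i with ht
  -- The ratio of consecutive terms is (K - i) j / ((i + 1) l); it is at least 1 for i < j and at
  -- most 1 for i ≥ j, so the terms peak at j.
  have hrec : ∀ i < K, t (i + 1) * ((i + 1) * l) = t i * ((K - i) * j) := by
    intro i hi
    have h1 := Nat.choose_succ_right_eq K i
    have h2 : l ^ (K - i) = l ^ (K - (i + 1)) * l := by rw [← pow_succ]; congr 1; omega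
    simp only [ht, h2, pow_succ]
    calc j ^ i * j * l ^ (K - (i + 1)) * K.choose (i + 1) * ((i + 1) * l)
        = j ^ i * j * l ^ (K - (i + 1)) * l * (K.choose (i + 1) * (i + 1)) := by ring
      _ = _ := by rw [h1]; ring
  have hup : ∀ i < j, t i ≤ t (i + 1) := by
    intro i hi
    have h1 := hrec i (by omega)
    have h2 : (i + 1) * l ≤ (K - i) * j := by
      rw [mul_comm]
      exact Nat.mul_le_mul (by omega) (by omega)
    have h3 : t i * ((i + 1) * l) ≤ t (i + 1) * ((i + 1) * l) := by
      rw [h1]; exact Nat.mul_le_mul_left _ h2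
    exact Nat.le_of_mul_le_mul_right h3 (by positivity)
  have hdown : ∀ i, j ≤ i → i < K → t (i + 1) ≤ t i := by
    intro i hi hiK
    have h1 := hrec i hiK
    have h2 : (K - i) * j ≤ (i + 1) * l := by
      rw [mul_comm]
      exact Nat.mul_le_mul (by omega) (by omega)
    have h3 : t (i + 1) * ((i + 1) * l) ≤ t i * ((i + 1) * l) := by
      rw [h1]; exact Nat.mul_le_mul_left _ h2
    exact Nat.le_of_mul_le_mul_right h3 (by positivity)
  have hle : ∀ i ≤ K, t i ≤ t j := by
    intro i hi
    rcases le_total i j with h | h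
    · induction h using Nat.decreasingInduction with
      | self => exact le_rfl
      | of_succ k hk ih => exact (hup k hk).trans (ih (by omega))
    · induction i, h using Nat.le_induction with
      | base => exact le_rfl
      | succ k hk ih => exact (hdown k hk (by omega)).trans (ih (by omega))
  have hsum : K ^ K = ∑ i ∈ Finset.range (K + 1), t i := by
    conv_lhs => rw [hK, add_pow]
    rfl
  rw [hsum]
  refine (Finset.sum_le_card_nsmul _ _ (t j) fun i hi => hle i (by
    have := Finset.mem_range.1 hi; omega)).trans (le_of_eq ?_)
  have : K - j = l := by omega
  simp only [ht, Finset.card_range, smul_eq_mul, this]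
  ring

/-- The binomial probabilities. -/
def binomialProb (p : ℝ) (k j : ℕ) : ℝ := k.choose j * (p ^ j * (1 - p) ^ (k - j))

lemma binomialProb_nonneg {p : ℝ} (h0 : 0 ≤ p) (h1 : p ≤ 1) (k j : ℕ) : 0 ≤ binomialProb p k j := by
  have : 0 ≤ 1 - p := by linarith
  unfold binomialProb; positivity

lemma binomialProb_succ (p : ℝ) (k j : ℕ) :
    binomialProb p (k + 1) (j + 1) = p * binomialProb p k j + (1 - p) * binomialProb p k (j + 1) := by
  unfold binomialProb
  rw [Nat.choose_succ_succ, Nat.add_sub_add_right]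
  rcases Nat.lt_or_ge k (j + 1) with h | h
  · rw [Nat.choose_eq_zero_of_lt h]
    push_cast; ring
  · have : k - j = k - (j + 1) + 1 := by omega
    rw [this]
    push_cast; ring

lemma binomialProb_le_one {p : ℝ} (h0 : 0 ≤ p) (h1 : p ≤ 1) (k j : ℕ) : binomialProb p k j ≤ 1 := by
  rcases Nat.lt_or_ge k j with h | h
  · simp [binomialProb, Nat.choose_eq_zero_of_lt h]
  · have h2 : ∑ j ∈ Finset.range (k + 1), binomialProb p k j = 1 := by
      have := add_pow p (1 - p) k
      rw [add_sub_cancel, one_pow] at this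
      rw [this]
      exact Finset.sum_congr rfl fun i _ => by unfold binomialProb; ring
    rw [← h2]
    exact Finset.single_le_sum (f := fun j => binomialProb p k j)
      (fun i _ => binomialProb_nonneg h0 h1 k i) (Finset.mem_range.2 (by omega))

/-! ### Hitting times on the biased line -/

namespace WeightedGraph

variable {V : Type u}

lemma killed_sum (G : WeightedGraph V) (z : Set V) {ι : Type*} (s : Finset ι) (f : ι → V → ℝ≥0∞)
    (x : V) : G.killed z (fun y => ∑ i ∈ s, f i y) x = ∑ i ∈ s, G.killed z (f i) x := by
  have h := congrFun (killed_tsum G z (fun i : s => f i)) x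
  simp only [tsum_fintype] at h
  rw [← Finset.sum_coe_sort s, ← h]
  congr 1
  ext y
  exact (Finset.sum_coe_sort s (fun i => f i y)).symm

section Line

variable {G : WeightedGraph V} {g : ℝ} {e : V ≃ ℤ}

/-- The vertex set is only identified with ℤ, so that the computations serve both `biasedLine` and
its copy in another universe. -/
lemma tsum_biasedWeight_mul (hw : ∀ x y, G.weight x y = biasedWeight g (e x) (e y)) (x : V)
    (h : V → ℝ≥0∞) :
    ∑' y, G.weight x y * h y = ENNReal.ofReal (g ^ e x) * h (e.symm (e x + 1)) +
      ENNReal.ofReal (g ^ (e x - 1)) * h (e.symm (e x - 1)) := by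
  rw [← e.symm.tsum_eq, tsum_eq_sum (s := {e x + 1, e x - 1})]
  · rw [Finset.sum_pair (by omega)]
    simp [hw, biasedWeight, show e x - 1 ≠ e x + 1 by omega]
  · intro j hj
    simp only [Finset.mem_insert, Finset.mem_singleton, not_or] at hj
    rw [hw, biasedWeight, Equiv.apply_symm_apply, if_neg hj.1, if_neg (by omega), zero_mul]

lemma vertexWeight_line (hg : 1 < g) (hw : ∀ x y, G.weight x y = biasedWeight g (e x) (e y)) (x : V) :
    G.vertexWeight x = ENNReal.ofReal (g ^ (e x - 1) * (g + 1)) := by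
  have h := tsum_biasedWeight_mul hw x 1
  simp only [Pi.one_apply, mul_one] at h
  have hg0 : 0 < g := by linarith
  rw [vertexWeight, h, ← ENNReal.ofReal_add (by positivity) (by positivity)]
  congr 1
  rw [zpow_sub_one₀ hg0.ne']
  field_simp

lemma tsum_step_mul_line (hg : 1 < g) (hw : ∀ x y, G.weight x y = biasedWeight g (e x) (e y)) (x : V)
    (h : V → ℝ≥0∞) :
    ∑' y, G.step x y * h y = ENNReal.ofReal (g / (g + 1)) * h (e.symm (e x + 1)) +
      ENNReal.ofReal (1 - g / (g + 1)) * h (e.symm (e x - 1)) := by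
  have hg0 : 0 < g := by linarith
  have hz : 0 < g ^ (e x - 1) := by positivity
  have h1 : ∑' y, G.step x y * h y = (G.vertexWeight x)⁻¹ * ∑' y, G.weight x y * h y := by
    rw [← ENNReal.tsum_mul_left]
    refine tsum_congr fun y => ?_
    rw [step_apply]; ring
  rw [h1, tsum_biasedWeight_mul hw, vertexWeight_line hg hw, mul_add, ← mul_assoc, ← mul_assoc,
    ← ENNReal.ofReal_inv_of_pos (by positivity), ← ENNReal.ofReal_mul (by positivity),
    ← ENNReal.ofReal_mul (by positivity)]
  congr 3
  · have : g ^ e x = g ^ (e x - 1) * g := by rw [zpow_sub_one₀ hg0.ne']; field_simp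
    rw [this]; field_simp
  · field_simp; ring

lemma killed_line (hg : 1 < g) (hw : ∀ x y, G.weight x y = biasedWeight g (e x) (e y)) (N : ℤ)
    (x : V) (f : V → ℝ≥0∞) :
    G.killed {e.symm N} f x =
      ENNReal.ofReal (g / (g + 1)) * (if e x + 1 = N then 0 else f (e.symm (e x + 1))) +
      ENNReal.ofReal (1 - g / (g + 1)) * (if e x - 1 = N then 0 else f (e.symm (e x - 1))) := by
  have h : ∀ i, ({e.symm N}ᶜ : Set V).indicator f (e.symm i) = if i = N then 0 else f (e.symm i) := by
    intro i
    by_cases h : i = N <;> simp [h]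
  rw [killed, tsum_step_mul_line hg hw, h, h]

lemma enter_line (hg : 1 < g) (hw : ∀ x y, G.weight x y = biasedWeight g (e x) (e y)) (N : ℤ)
    (x : V) : G.enter {e.symm N} x =
      ENNReal.ofReal (g / (g + 1)) * (if e x + 1 = N then 1 else 0) +
      ENNReal.ofReal (1 - g / (g + 1)) * (if e x - 1 = N then 1 else 0) := by
  have h : ∀ i, ({e.symm N} : Set V).indicator (1 : V → ℝ≥0∞) (e.symm i) = if i = N then 1 else 0 := by
    intro i
    by_cases h : i = N <;> simp [h]
  rw [enter, tsum_step_mul_line hg hw, h, h]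

/-- The linear function m_g (N - x) vanishes at N and solves the one-step equation for the mean
exactly. By induction it dominates all partial sums of survival probabilities. -/
lemma meanHit_line_le (hg : 1 < g) (hw : ∀ x y, G.weight x y = biasedWeight g (e x) (e y)) (N : ℤ)
    (x : V) (hx : e x < N) :
    G.meanHit x {e.symm N} ≤ ENNReal.ofReal (biasedSlowness g * (N - e x)) := by
  have hxz : x ∉ ({e.symm N} : Set V) := by
    rintro rfl; simp at hx
  have hm := one_le_biasedSlowness hg
  have hp0 : 0 ≤ g / (g + 1) := by positivity
  have hp1 : 0 ≤ 1 - g / (g + 1) := by rw [sub_nonneg, div_le_one (by linarith)]; linarith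
  rw [meanHit_eq G _ x hxz, ENNReal.tsum_eq_iSup_nat]
  refine iSup_le fun K => ?_
  clear hxz
  induction K generalizing x with
  | zero => simp
  | succ K ih =>
    have hrec : ∑ k ∈ Finset.range (K + 1), (G.killed {e.symm N})^[k] 1 x =
        1 + G.killed {e.symm N} (fun y => ∑ k ∈ Finset.range K, (G.killed {e.symm N})^[k] 1 y) x := by
      rw [killed_sum, Finset.sum_range_succ', add_comm]
      simp only [Function.iterate_succ_apply']
      rfl
    rw [hrec, killed_line hg hw, if_neg (show e x - 1 ≠ N by omega)]
    have h1 : (if e x + 1 = N then 0 else ∑ k ∈ Finset.range K,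
        (G.killed {e.symm N})^[k] 1 (e.symm (e x + 1))) ≤
        ENNReal.ofReal (biasedSlowness g * (N - (e x + 1))) := by
      split_ifs with h
      · exact zero_le
      · exact (ih (e.symm (e x + 1)) (by rw [Equiv.apply_symm_apply]; omega)).trans (by simp)
    have h2 : ∑ k ∈ Finset.range K, (G.killed {e.symm N})^[k] 1 (e.symm (e x - 1)) ≤
        ENNReal.ofReal (biasedSlowness g * (N - (e x - 1))) := by
      exact (ih (e.symm (e x - 1)) (by rw [Equiv.apply_symm_apply]; omega)).trans (by simp)
    refine (add_le_add_right (add_le_add (mul_le_mul_right h1 _) (mul_le_mul_right h2 _)) _).trans ?_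
    have hN : (0 : ℝ) ≤ N - (e x + 1) := by
      have : ((e x + 1 : ℤ) : ℝ) ≤ N := by exact_mod_cast hx
      push_cast at this; linarith
    rw [← ENNReal.ofReal_mul hp0, ← ENNReal.ofReal_mul hp1, ← ENNReal.ofReal_one,
      ← ENNReal.ofReal_add, ← ENNReal.ofReal_add]
    · refine ENNReal.ofReal_le_ofReal (le_of_eq ?_)
      have h3 : g - 1 ≠ 0 := by linarith
      have h4 : g + 1 ≠ 0 := by linarith
      unfold biasedSlowness
      field_simp
      ring
    · exact zero_le_one
    · exact add_nonneg (mul_nonneg hp0 (mul_nonneg (by linarith) hN))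
        (mul_nonneg hp1 (mul_nonneg (by linarith) (by linarith)))
    · exact mul_nonneg hp0 (mul_nonneg (by linarith) hN)
    · exact mul_nonneg hp1 (mul_nonneg (by linarith) (by linarith))

lemma sum_hitProb_succ (G : WeightedGraph V) (z : Set V) (k : ℕ) (x : V) :
    ∑ i ∈ Finset.range (k + 1), G.hitProb z i x =
      G.enter z x + G.killed z (fun y => ∑ i ∈ Finset.range k, G.hitProb z i y) x := by
  rw [killed_sum, Finset.sum_range_succ', add_comm]
  simp only [hitProb_succ]
  rfl

lemma sum_pow_mul_hitProb_succ (G : WeightedGraph V) (z : Set V) (s : ℝ≥0∞) (k : ℕ) (x : V) :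
    ∑ i ∈ Finset.range (k + 1), s ^ (i + 1) * G.hitProb z i x =
      s * (G.enter z x + G.killed z (fun y => ∑ i ∈ Finset.range k, s ^ (i + 1) * G.hitProb z i y) x) := by
  rw [killed_sum, Finset.sum_range_succ', add_comm, mul_add, Finset.mul_sum]
  simp only [hitProb_succ, killed_const_mul, zero_add, pow_one]
  congr 1
  exact Finset.sum_congr rfl fun i _ => by ring

/-- The equation from which `logDiscount` arises: exponentials are eigenfunctions of the biased
step, and the discount is the inverse eigenvalue. -/
lemma exp_logDiscount_mul (hg : 0 < g) (L y : ℝ) :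
    Real.exp (logDiscount g L) * (g / (g + 1) * Real.exp (L * (y - 1)) +
      (1 - g / (g + 1)) * Real.exp (L * (y + 1))) = Real.exp (L * y) := by
  have h1 : Real.exp (logDiscount g L) = (g + 1) * Real.exp L / (g + Real.exp L ^ 2) := by
    rw [logDiscount, Real.exp_sub, Real.exp_add, Real.exp_log (by positivity),
      Real.exp_log (by positivity), ← Real.exp_nat_mul]
    norm_num
  rw [h1, mul_sub L, mul_add L, mul_one, Real.exp_sub, Real.exp_add]
  have := Real.exp_pos L
  field_simp
  ring

/-- The exponential is a bounded solution of the one-step equation with value 1 at N. It dominates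
the partial sums; conversely, K iterations leave a remainder of at most s^K, which tends to 0. -/
lemma hitGen_line (hg : 1 < g) (hw : ∀ x y, G.weight x y = biasedWeight g (e x) (e y)) (N : ℤ)
    (x : V) (hx : e x < N) {L : ℝ} (hL : L < 0) :
    G.hitGen {e.symm N} (ENNReal.ofReal (Real.exp (logDiscount g L))) x =
      ENNReal.ofReal (Real.exp (L * (N - e x))) := by
  have hp0 : 0 ≤ g / (g + 1) := by positivity
  have hp1 : 0 ≤ 1 - g / (g + 1) := by rw [sub_nonneg, div_le_one (by linarith)]; linarith
  set s := ENNReal.ofReal (Real.exp (logDiscount g L)) with hs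
  have hs1 : s < 1 := by
    rw [hs, ENNReal.ofReal_lt_one]
    exact (Real.exp_lt_exp.2 (logDiscount_neg hg hL)).trans_eq Real.exp_zero
  have hharm : ∀ i : ℤ, s * (ENNReal.ofReal (g / (g + 1)) *
      ENNReal.ofReal (Real.exp (L * (N - (i + 1 : ℤ)))) + ENNReal.ofReal (1 - g / (g + 1)) *
      ENNReal.ofReal (Real.exp (L * (N - (i - 1 : ℤ))))) =
      ENNReal.ofReal (Real.exp (L * (N - i))) := by
    intro i
    rw [← ENNReal.ofReal_mul hp0, ← ENNReal.ofReal_mul hp1, ← ENNReal.ofReal_add (by positivity)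
      (mul_nonneg hp1 (by positivity)), hs, ← ENNReal.ofReal_mul (by positivity),
      ← exp_logDiscount_mul (g := g) (by linarith) L ((N : ℝ) - i)]
    push_cast
    ring_nf
  refine le_antisymm ?_ ?_
  · rw [hitGen, ENNReal.tsum_eq_iSup_nat]
    refine iSup_le fun K => ?_
    induction K generalizing x with
    | zero => simp
    | succ K ih =>
      rw [sum_pow_mul_hitProb_succ, ← hharm, killed_line hg hw, enter_line hg hw,
        if_neg (show e x - 1 ≠ N by omega), if_neg (show e x - 1 ≠ N by omega), mul_zero, add_zero,
        ← add_assoc, ← mul_add]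
      gcongr
      · split_ifs with h
        · rw [add_zero, h]; simp
        · rw [zero_add]
          exact (ih (e.symm (e x + 1)) (by rw [Equiv.apply_symm_apply]; omega)).trans (by simp)
      · exact (ih (e.symm (e x - 1)) (by rw [Equiv.apply_symm_apply]; omega)).trans (by simp)
  · have h : ∀ K : ℕ, ENNReal.ofReal (Real.exp (L * (N - e x))) ≤
        G.hitGen {e.symm N} s x + s ^ K := by
      intro K
      induction K generalizing x with
      | zero =>
        refine le_add_left ?_
        rw [pow_zero, ENNReal.ofReal_le_one, Real.exp_le_one_iff]
        have : (e x : ℝ) < N := by exact_mod_cast hx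
        nlinarith
      | succ K ih =>
        rw [← hharm, hitGen_eq, killed_line hg hw, enter_line hg hw,
          if_neg (show e x - 1 ≠ N by omega), if_neg (show e x - 1 ≠ N by omega), mul_zero, add_zero,
          ← add_assoc, ← mul_add, pow_succ', ← mul_add]
        refine mul_le_mul_right ?_ _
        have hone : ENNReal.ofReal (g / (g + 1)) + ENNReal.ofReal (1 - g / (g + 1)) = 1 := by
          rw [← ENNReal.ofReal_add hp0 hp1]; simp
        have hK : s ^ K = ENNReal.ofReal (g / (g + 1)) * s ^ K +
            ENNReal.ofReal (1 - g / (g + 1)) * s ^ K := by rw [← add_mul, hone, one_mul]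
        rw [hK, add_add_add_comm, ← mul_add, ← mul_add]
        refine add_le_add (mul_le_mul_right ?_ _) (mul_le_mul_right ?_ _)
        · split_ifs with h
          · rw [h]; simp
          · rw [zero_add]
            exact (le_of_eq (by simp)).trans
              (ih (e.symm (e x + 1)) (by rw [Equiv.apply_symm_apply]; omega))
        · exact (le_of_eq (by simp)).trans
            (ih (e.symm (e x - 1)) (by rw [Equiv.apply_symm_apply]; omega))
    have hlim := (tendsto_const_nhds (x := G.hitGen {e.symm N} s x)).add
      (ENNReal.tendsto_pow_atTop_nhds_zero_of_lt_one hs1)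
    rw [add_zero] at hlim
    exact ge_of_tendsto' hlim h

/-- A free walk that is at N at time k has hit N by then. Both sides obey the same first-step
recursion until N is reached, where the hitting probability becomes 1. -/
lemma binomialProb_le_line (hg : 1 < g) (hw : ∀ x y, G.weight x y = biasedWeight g (e x) (e y))
    (N : ℤ) (x : V) (hx : e x < N) (k j : ℕ) (hj : e x + 2 * j - k = N) :
    ENNReal.ofReal (binomialProb (g / (g + 1)) k j) ≤
      ∑ i ∈ Finset.range k, G.hitProb {e.symm N} i x := by
  have hp0 : 0 ≤ g / (g + 1) := by positivity
  have hp1 : g / (g + 1) ≤ 1 := by rw [div_le_one (by linarith)]; linarith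
  induction k generalizing x j with
  | zero =>
    obtain ⟨j, rfl⟩ : ∃ i, j = i + 1 := ⟨j - 1, by omega⟩
    simp [binomialProb]
  | succ k ih =>
    obtain ⟨j, rfl⟩ : ∃ i, j = i + 1 := ⟨j - 1, by omega⟩
    rw [binomialProb_succ, sum_hitProb_succ, killed_line hg hw, enter_line hg hw,
      if_neg (show e x - 1 ≠ N by omega), if_neg (show e x - 1 ≠ N by omega), mul_zero, add_zero,
      ← add_assoc, ← mul_add, ENNReal.ofReal_add (mul_nonneg hp0 (binomialProb_nonneg hp0 hp1 _ _))
      (mul_nonneg (by linarith) (binomialProb_nonneg hp0 hp1 _ _)), ENNReal.ofReal_mul hp0,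
      ENNReal.ofReal_mul (by linarith)]
    refine add_le_add (mul_le_mul_right ?_ _) (mul_le_mul_right ?_ _)
    · split_ifs with h
      · rw [add_zero]
        exact ENNReal.ofReal_le_one.2 (binomialProb_le_one hp0 hp1 _ _)
      · rw [zero_add]
        refine ih _ (by rw [Equiv.apply_symm_apply]; omega) _ ?_
        rw [Equiv.apply_symm_apply]
        push_cast at hj
        linarith
    · refine ih _ (by rw [Equiv.apply_symm_apply]; omega) _ ?_
      rw [Equiv.apply_symm_apply]
      push_cast at hj ⊢
      linarith

lemma admissible_line {C : ℝ} (hC : 1 < C) (hg : 1 < g)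
    (hw : ∀ x y, G.weight x y = biasedWeight g (e x) (e y)) (n : ℕ) :
    Admissible C g n G (e.symm 0) {e.symm n} := by
  have hg0 : 0 < g := by linarith
  constructor
  · have hwalk : ∀ (x y : V) (p : G.toSimpleGraph.Walk x y), e y ≤ e x + p.length := by
      intro x y p
      induction p with
      | nil => simp
      | @cons a b c h p ih =>
        have h1 : e b ≤ e a + 1 := by
          have h2 := h.2
          rw [hw, biasedWeight] at h2
          split_ifs at h2 <;> first | omega | exact absurd rfl h2
        rw [SimpleGraph.Walk.length_cons]
        push_cast
        linarith
    rw [distToSet]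
    simp only [Set.mem_singleton_iff, iInf_iInf_eq_left]
    refine le_iInf fun p => ?_
    have := hwalk _ _ p
    simp only [Equiv.apply_symm_apply, zero_add] at this
    exact_mod_cast this
  · rw [setWeight, tsum_singleton (e.symm (n : ℤ)) G.vertexWeight, vertexWeight_line hg hw,
      vertexWeight_line hg hw, ← ENNReal.ofReal_div_of_pos (by positivity)]
    refine ENNReal.ofReal_le_ofReal ?_
    simp only [Equiv.apply_symm_apply, zero_sub]
    rw [zpow_sub_one₀ hg0.ne', zpow_neg_one, zpow_natCast, mul_right_comm,
      mul_comm g⁻¹ (g + 1), ← div_div, mul_div_assoc]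
    field_simp
    nlinarith [pow_pos hg0 n]

end Line

/-! ### Bounds for the infimum and the supremum -/

/-- Needed for n = 0, where the start may lie in z and the series formulas do not apply. -/
lemma ae_hitTime_eq_zero [MeasurableSpace V] [DiscreteMeasurableSpace V] (G : WeightedGraph V)
    {z : Set V} {o : V} (ho : o ∈ z) : ∀ᵐ ω ∂G.walkLaw o, hitTime z ω = 0 := by
  have h1 := lintegral_walkLaw_zero G o (zᶜ.indicator 1)
  rw [Set.indicator_of_notMem (by simpa using ho)] at h1
  have hm : Measurable fun ω : ℕ → V => zᶜ.indicator (1 : V → ℝ≥0∞) (ω 0) :=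
    (Measurable.of_discrete (f := zᶜ.indicator (1 : V → ℝ≥0∞))).comp (measurable_pi_apply 0)
  rw [lintegral_eq_zero_iff hm] at h1
  filter_upwards [h1] with ω hω
  have h2 : ω 0 ∈ z := by
    by_contra h
    simp [h] at hω
  exact le_antisymm (iInf₂_le 0 h2) zero_le

lemma meanHit_eq_zero (G : WeightedGraph V) {z : Set V} {o : V} (ho : o ∈ z) :
    G.meanHit o z = 0 := by
  let _ : MeasurableSpace V := ⊤
  have : DiscreteMeasurableSpace V := ⟨fun _ => trivial⟩
  unfold meanHit expectHit
  rw [lintegral_congr_ae (g := fun _ => 0)]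
  · simp
  · filter_upwards [G.ae_hitTime_eq_zero ho] with ω hω
    simp [hω]

lemma probHitLE_eq_one (G : WeightedGraph V) {z : Set V} {o : V} (ho : o ∈ z) {t : ℝ} (ht : 0 ≤ t) :
    G.probHitLE o z t = 1 := by
  let _ : MeasurableSpace V := ⊤
  have : DiscreteMeasurableSpace V := ⟨fun _ => trivial⟩
  unfold probHitLE
  refine le_antisymm prob_le_one ?_
  rw [← measure_univ (μ := G.walkLaw o)]
  refine measure_mono_ae ?_
  filter_upwards [G.ae_hitTime_eq_zero ho] with ω hω _
  change (((hitTime z ω : ℕ∞) : ℝ≥0∞) : EReal) ≤ (t : EReal)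
  simp [hω, ht]

lemma probHitLE_le_one (G : WeightedGraph V) (z : Set V) (o : V) (t : ℝ) :
    G.probHitLE o z t ≤ 1 := by
  let _ : MeasurableSpace V := ⊤
  have : DiscreteMeasurableSpace V := ⟨fun _ => trivial⟩
  exact prob_le_one

/-- The Chernoff bound. -/
lemma probHitLE_le (G : WeightedGraph V) (z : Set V) (o : V) (ho : o ∉ z) {t σ : ℝ} (ht : 0 ≤ t)
    (hσ : σ ≤ 0) :
    G.probHitLE o z t ≤ ENNReal.ofReal (Real.exp (-(σ * t))) *
      G.hitGen z (ENNReal.ofReal (Real.exp σ)) o := by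
  rw [probHitLE_eq G z o ho t ht, hitGen, ← ENNReal.tsum_mul_left]
  refine le_trans (Finset.sum_le_sum fun k hk => ?_) (ENNReal.sum_le_tsum (Finset.range ⌊t⌋₊))
  rw [← mul_assoc, ← ENNReal.ofReal_pow (by positivity), ← ENNReal.ofReal_mul (by positivity)]
  refine le_mul_of_one_le_left' ?_
  rw [ENNReal.one_le_ofReal, ← Real.exp_nat_mul, ← Real.exp_add]
  refine Real.one_le_exp ?_
  have h1 : ((k + 1 : ℕ) : ℝ) ≤ t := (Nat.le_floor_iff ht).1 (Finset.mem_range.1 hk)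
  nlinarith

/-- The biased line with vertices in an arbitrary universe. -/
def liftedLine (g : ℝ) (hg : 1 < g) : WeightedGraph (ULift.{u} ℤ) where
  weight x y := biasedWeight g x.down y.down
  symm x y := (biasedLine g hg).symm _ _
  total_ne_zero x := by
    rw [show ∑' y : ULift.{u} ℤ, biasedWeight g x.down y.down = ∑' j, biasedWeight g x.down j from
      Equiv.ulift.tsum_eq _]
    exact (biasedLine g hg).total_ne_zero _
  total_ne_top x := by
    rw [show ∑' y : ULift.{u} ℤ, biasedWeight g x.down y.down = ∑' j, biasedWeight g x.down j from
      Equiv.ulift.tsum_eq _]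
    exact (biasedLine g hg).total_ne_top _

variable {C g : ℝ} {n : ℕ}

lemma admissible_liftedLine (hC : 1 < C) (hg : 1 < g) (n : ℕ) :
    Admissible C g n (liftedLine.{u} g hg) (Equiv.ulift.symm 0) {Equiv.ulift.symm (n : ℤ)} :=
  admissible_line (e := Equiv.ulift) hC hg (fun _ _ => rfl) n

lemma infMeanHit_le (hC : 1 < C) (hg : 1 < g) (n : ℕ) :
    infMeanHit.{u} C g n ≤ ENNReal.ofReal (biasedSlowness g * n) := by
  refine iInf_le_of_le (ULift.{u} ℤ) ?_
  refine iInf_le_of_le (liftedLine.{u} g hg) ?_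
  refine iInf_le_of_le (Equiv.ulift.symm 0) ?_
  refine iInf_le_of_le {Equiv.ulift.symm (n : ℤ)} ?_
  refine iInf_le_of_le (admissible_liftedLine hC hg n) ?_
  rcases Nat.eq_zero_or_pos n with rfl | hn
  · rw [meanHit_eq_zero _ (by simp)]
    exact zero_le
  · exact (meanHit_line_le (e := Equiv.ulift) hg (fun _ _ => rfl) n _ (by simpa using hn)).trans
      (by simp)

lemma le_infMeanHit (hC : 1 < C) (hg : 1 < g) (hn : 2 ≤ n) (hnK : stepLoss C g < n) :
    ENNReal.ofReal (biasedSlowness g * (n - stepLoss C g)) ≤ infMeanHit.{u} C g n := by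
  refine le_iInf fun V => le_iInf fun G => le_iInf fun o => le_iInf fun z => le_iInf fun h => ?_
  have hn0 : (0 : ℝ) < n := by positivity
  have hK1 : 0 < 1 - stepLoss C g / n := by rw [sub_pos, div_lt_one hn0]; exact hnK
  refine le_trans (le_of_eq ?_) (G.le_meanHit z o (h.notMem (by omega)) (κ := (1 - stepLoss C g / n)⁻¹)
    (ν := n) hg (by positivity) fun L hL => G.hitGen_le hC hg hn hnK h hL)
  congr 1
  field_simp

lemma supProbHitLE_le_one (C g : ℝ) (n : ℕ) (t : ℝ) : supProbHitLE.{u} C g n t ≤ 1 :=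
  iSup_le fun _ => iSup_le fun G => iSup_le fun o => iSup_le fun z => iSup_le fun _ =>
    G.probHitLE_le_one z o t

lemma binomialProb_le_supProbHitLE (hC : 1 < C) (hg : 1 < g) (hn : 1 ≤ n) {t : ℝ} (ht : 0 ≤ t)
    {k j : ℕ} (hk : (k : ℝ) ≤ t) (hj : 2 * j = n + k) :
    ENNReal.ofReal (binomialProb (g / (g + 1)) k j) ≤ supProbHitLE.{u} C g n t := by
  have h := admissible_liftedLine.{u} hC hg n
  refine le_trans ?_ (le_iSup_of_le _ (le_iSup_of_le (liftedLine.{u} g hg) (le_iSup_of_le _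
    (le_iSup_of_le _ (le_iSup_of_le h le_rfl)))))
  rw [probHitLE_eq _ _ _ (h.notMem hn) t ht]
  refine (binomialProb_le_line (e := Equiv.ulift) hg (fun _ _ => rfl) n _ ?_ k j ?_).trans
    (Finset.sum_le_sum_of_subset (Finset.range_mono ((Nat.le_floor_iff ht).2 hk)))
  · simp only [Equiv.apply_symm_apply]
    exact_mod_cast hn
  · simp only [Equiv.apply_symm_apply]
    omega

/-- The walk may take n steps to the right in a row. Positivity for every n allows the error term to
be defined through a logarithm. -/
lemma supProbHitLE_pos (hC : 1 < C) (hg : 1 < g) (n : ℕ) {a : ℝ} (ha : 1 < a) :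
    0 < supProbHitLE.{u} C g n (a * n) := by
  rcases Nat.eq_zero_or_pos n with rfl | hn
  · refine lt_of_lt_of_le one_pos (le_trans (le_of_eq ?_) (le_iSup_of_le _ (le_iSup_of_le
      (liftedLine.{u} g hg) (le_iSup_of_le _ (le_iSup_of_le _
      (le_iSup_of_le (admissible_liftedLine.{u} hC hg 0) le_rfl))))))
    rw [probHitLE_eq_one _ (by simp) (by simp)]
  · refine lt_of_lt_of_le ?_ (binomialProb_le_supProbHitLE.{u} hC hg hn (k := n) (j := n)
      (by positivity) (le_mul_of_one_le_left (by positivity) ha.le) (by ring))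
    rw [ENNReal.ofReal_pos]
    have : 0 < g := by linarith
    simp only [binomialProb, Nat.choose_self, Nat.sub_self, pow_zero]
    positivity

lemma supProbHitLE_le (hC : 1 < C) (hg : 1 < g) (hn : 2 ≤ n) (hnK : stepLoss C g < n) {a L : ℝ}
    (ha : 0 ≤ a) (hL : L < 0) :
    supProbHitLE.{u} C g n (a * n) ≤
      ENNReal.ofReal (Real.exp (n * L - logDiscount g L / (1 - stepLoss C g / n) * (a * n))) := by
  have hn0 : (0 : ℝ) < n := by positivity
  have hK1 : 0 < 1 - stepLoss C g / n := by rw [sub_pos, div_lt_one hn0]; exact hnK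
  refine iSup_le fun V => iSup_le fun G => iSup_le fun o => iSup_le fun z => iSup_le fun h => ?_
  refine (G.probHitLE_le z o (h.notMem (by omega)) (by positivity)
    (div_neg_of_neg_of_pos (logDiscount_neg hg hL) hK1).le).trans
    ((mul_le_mul_right (G.hitGen_le hC hg hn hnK h hL) _).trans (le_of_eq ?_))
  rw [← ENNReal.ofReal_mul (by positivity), ← Real.exp_add]
  congr 2
  ring

end WeightedGraph

/-! ### The mean and the rate function of the biased walk -/

section Rate

variable {g : ℝ}

lemma meanHit_biasedLine (hg : 1 < g) :
    (biasedLine g hg).meanHit 0 {1} = ENNReal.ofReal (biasedSlowness g) := by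
  refine le_antisymm ?_ ?_
  · have := WeightedGraph.meanHit_line_le (G := biasedLine g hg) (e := Equiv.refl ℤ) hg
      (fun _ _ => rfl) 1 0 (by simp)
    simpa using this
  · have := WeightedGraph.le_meanHit (biasedLine g hg) {1} 0 (by simp) (κ := 1) (ν := 1) hg one_pos
      fun L hL => ?_
    · simpa using this
    · have h := WeightedGraph.hitGen_line (G := biasedLine g hg) (e := Equiv.refl ℤ) hg
        (fun _ _ => rfl) 1 0 (by simp) hL
      simp only [Equiv.refl_symm, Equiv.refl_apply] at h
      rw [mul_one, h]
      simp

lemma biasedMean_eq (hg : 1 < g) : biasedMean g hg = biasedSlowness g := by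
  rw [biasedMean, meanHit_biasedLine,
    ENNReal.toReal_ofReal (by linarith [one_le_biasedSlowness hg])]

lemma ereal_exp_mul_natCast (l : ℝ) (k : ℕ) :
    EReal.exp ((l : EReal) * ((((k : ℕ) : ℕ∞) : ℝ≥0∞) : EReal)) =
      ENNReal.ofReal (Real.exp l) ^ k := by
  have h : ((k : ℝ≥0∞) : EReal) = (k : EReal) := by
    rw [← ENNReal.ofReal_natCast, EReal.coe_ennreal_ofReal, max_eq_left (Nat.cast_nonneg k)]
    rfl
  rw [mul_comm, ← EReal.exp_coe, ← EReal.exp_nmul, ENat.toENNReal_coe, h]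

lemma biasedLogMGF_logDiscount (hg : 1 < g) {L : ℝ} (hL : L < 0) :
    biasedLogMGF g hg (logDiscount g L) = L := by
  have h := WeightedGraph.hitGen_line (G := biasedLine g hg) (e := Equiv.refl ℤ) hg
    (fun _ _ => rfl) 1 0 (by simp) hL
  simp only [Equiv.refl_symm, Equiv.refl_apply] at h
  have hl := logDiscount_neg hg hL
  rw [biasedLogMGF, WeightedGraph.expectHit_eq _ _ _ (by simp)]
  have h0 : EReal.exp (((logDiscount g L : ℝ) : EReal) * (((⊤ : ℕ∞) : ℝ≥0∞) : EReal)) = 0 := by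
    simp [EReal.coe_mul_top_of_neg hl]
  rw [h0, zero_mul, zero_add]
  simp_rw [ereal_exp_mul_natCast]
  change ENNReal.log (WeightedGraph.hitGen _ _ _ _) = _
  rw [h, ENNReal.log_ofReal_of_pos (Real.exp_pos _), Real.log_exp]
  simp

/-- Jensen's inequality, valid also when the exponential moment is infinite: the tangent of t ↦
e^(lt) at the mean is integrated termwise. The finite mean forces the probability of never hitting
to vanish. -/
lemma mul_le_biasedLogMGF (hg : 1 < g) {l : ℝ} (hl : 0 ≤ l) :
    ((l * biasedSlowness g : ℝ) : EReal) ≤ biasedLogMGF g hg l := by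
  have hm := one_le_biasedSlowness hg
  set m := biasedSlowness g with hmdef
  set p : ℕ → ℝ≥0∞ := fun k => (biasedLine g hg).hitProb {1} k 0 with hp
  have hmean := meanHit_biasedLine hg
  rw [WeightedGraph.meanHit, WeightedGraph.expectHit_eq _ _ _ (by simp)] at hmean
  have hmiss : (biasedLine g hg).missProb {1} 0 = 0 := by
    by_contra h
    rw [ENat.toENNReal_top, ENNReal.top_mul h, top_add] at hmean
    exact ENNReal.ofReal_ne_top hmean.symm
  have hsum := (biasedLine g hg).missProb_add {1} 0
  rw [hmiss, zero_add] at hsum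
  rw [hmiss, mul_zero, zero_add] at hmean
  rw [biasedLogMGF, WeightedGraph.expectHit_eq _ _ _ (by simp), hmiss, mul_zero, zero_add]
  simp_rw [ereal_exp_mul_natCast]
  set c := Real.exp (l * m) with hc
  have hc0 : 0 ≤ c := (Real.exp_pos _).le
  have hcm : 0 ≤ c * (l * m) := mul_nonneg hc0 (mul_nonneg hl (by linarith))
  have hterm : ∀ k : ℕ, ENNReal.ofReal c * p k +
      ENNReal.ofReal (c * l) * ((((k + 1 : ℕ) : ℕ∞) : ℝ≥0∞) * p k) ≤
      ENNReal.ofReal (Real.exp l) ^ (k + 1) * p k + ENNReal.ofReal (c * (l * m)) * p k := by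
    intro k
    rw [← mul_assoc, ← add_mul, ← add_mul]
    refine mul_le_mul_left ?_ _
    simp only [ENat.toENNReal_coe]
    rw [← ENNReal.ofReal_natCast, ← ENNReal.ofReal_pow (Real.exp_pos _).le,
      ← ENNReal.ofReal_mul (mul_nonneg hc0 hl), ← ENNReal.ofReal_add hc0 (by positivity),
      ← ENNReal.ofReal_add (by positivity) hcm]
    refine ENNReal.ofReal_le_ofReal ?_
    rw [← Real.exp_nat_mul]
    have h1 := Real.add_one_le_exp (((k + 1 : ℕ) : ℝ) * l - l * m)
    have h2 := mul_le_mul_of_nonneg_left h1 hc0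
    have h3 : c * Real.exp (((k + 1 : ℕ) : ℝ) * l - l * m) = Real.exp (((k + 1 : ℕ) : ℝ) * l) := by
      rw [hc, ← Real.exp_add]; congr 1; ring
    rw [h3] at h2
    linarith
  have htot := ENNReal.tsum_le_tsum hterm
  rw [ENNReal.tsum_add, ENNReal.tsum_add, ENNReal.tsum_mul_left, ENNReal.tsum_mul_left,
    ENNReal.tsum_mul_left, hmean, hsum, mul_one, mul_one, ← ENNReal.ofReal_mul (mul_nonneg hc0 hl),
    mul_assoc, ENNReal.add_le_add_iff_right ENNReal.ofReal_ne_top] at htot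
  have := ENNReal.log_monotone htot
  rwa [ENNReal.log_ofReal_of_pos (Real.exp_pos _), Real.log_exp] at this

lemma exists_logDiscount_eq (hg : 1 < g) {l : ℝ} (hl : l < 0) : ∃ L < 0, logDiscount g L = l := by
  have hcont : Continuous (logDiscount g) :=
    continuous_iff_continuousAt.2 fun L => (hasDerivAt_logDiscount (by linarith) L).continuousAt
  set L₀ := l + Real.log g - Real.log (g + 1) with hL₀
  have h1 : Real.log g ≤ Real.log (g + 1) := Real.log_le_log (by linarith) (by linarith)
  have h2 : logDiscount g L₀ ≤ l := by
    have : Real.log g ≤ Real.log (g + Real.exp (2 * L₀)) :=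
      Real.log_le_log (by linarith) (by linarith [Real.exp_pos (2 * L₀)])
    unfold logDiscount
    linarith
  obtain ⟨L, hL, hL'⟩ := intermediate_value_Icc (show L₀ ≤ 0 by linarith) hcont.continuousOn
    ⟨h2, by rw [logDiscount_zero]; exact hl.le⟩
  refine ⟨L, lt_of_le_of_ne hL.2 ?_, hL'⟩
  rintro rfl
  rw [logDiscount_zero] at hL'
  exact hl.ne' hL'

/-- The optimal exponent `L` in the Legendre transform at `a`. -/
def optExponent (g a : ℝ) : ℝ := Real.log (g * (a - 1) / (a + 1)) / 2

lemma exp_two_mul_optExponent {a : ℝ} (hg : 0 < g) (ha : 1 < a) :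
    Real.exp (2 * optExponent g a) = g * (a - 1) / (a + 1) := by
  have : 0 < a - 1 := by linarith
  rw [optExponent, mul_div_cancel₀ _ two_ne_zero, Real.exp_log (by positivity)]

lemma optExponent_neg {a : ℝ} (hg : 1 < g) (ha : 1 < a) (ha' : a < biasedSlowness g) :
    optExponent g a < 0 := by
  have h1 : 0 < a - 1 := by linarith
  rw [biasedSlowness, lt_div_iff₀ (by linarith)] at ha'
  refine div_neg_of_neg_of_pos (Real.log_neg (by positivity) ?_) two_pos
  rw [div_lt_one (by linarith)]
  linarith

/-- This is the tangent inequality at `optExponent` for the convex function log(g + e^(2L)). The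
weight π = (a-1)/(2a) is the proportion of left steps of a path advancing at speed 1/a, and the
proof is convexity of exp with weights 1 - π and π. -/
lemma mul_logDiscount_sub_le {a : ℝ} (hg : 1 < g) (ha : 1 < a) (L : ℝ) :
    a * logDiscount g L - L ≤ a * logDiscount g (optExponent g a) - optExponent g a := by
  set M := optExponent g a with hM
  have hE := exp_two_mul_optExponent (g := g) (by linarith) ha
  rw [← hM] at hE
  have ha1 : 0 < a - 1 := by linarith
  have hd : 0 < g + Real.exp (2 * M) := by linarith [Real.exp_pos (2 * M)]
  set π := (a - 1) / (2 * a) with hπ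
  have hπ0 : 0 ≤ π := by positivity
  have hπ1 : 0 ≤ 1 - π := by
    rw [hπ, sub_nonneg, div_le_one (by linarith)]; linarith
  have h1 : Real.exp (2 * π * (L - M)) ≤ (1 - π) + π * Real.exp (2 * (L - M)) := by
    have := convexOn_exp.2 (Set.mem_univ 0) (Set.mem_univ (2 * (L - M))) hπ1 hπ0 (by ring)
    simp only [smul_eq_mul, mul_zero, zero_add, Real.exp_zero, mul_one] at this
    refine le_trans (le_of_eq ?_) this
    ring_nf
  have h2 : (1 - π) + π * Real.exp (2 * (L - M)) =
      (g + Real.exp (2 * L)) / (g + Real.exp (2 * M)) := by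
    rw [mul_sub, Real.exp_sub, hE, hπ]
    field_simp
    ring
  rw [h2, ← Real.le_log_iff_exp_le (by positivity), Real.log_div (by positivity) hd.ne'] at h1
  have h3 : 2 * π * a = a - 1 := by rw [hπ]; field_simp
  have h4 := mul_le_mul_of_nonneg_left h1 (show 0 ≤ a by linarith)
  have h5 : a * (2 * π * (L - M)) = (a - 1) * (L - M) := by rw [← h3]; ring
  unfold logDiscount
  linarith

/-- Negative l are exactly the values of `logDiscount` at negative L. For l ≥ 0, Jensen bounds the
expression by l (a - m_g) ≤ 0, so such l do not matter. -/
lemma biasedRate_eq {a : ℝ} (hg : 1 < g) (ha : 1 < a) (ha' : a < biasedSlowness g) :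
    biasedRate g hg a = a * logDiscount g (optExponent g a) - optExponent g a := by
  set J := a * logDiscount g (optExponent g a) - optExponent g a with hJ
  have hJ0 : 0 ≤ J := by
    have := mul_logDiscount_sub_le hg ha 0
    rw [logDiscount_zero] at this
    linarith
  have hsup : (⨆ l : ℝ, ((l * a : ℝ) : EReal) - biasedLogMGF g hg l) = (J : EReal) := by
    refine le_antisymm (iSup_le fun l => ?_) ?_
    · rcases lt_or_ge l 0 with hl | hl
      · obtain ⟨L, hL, rfl⟩ := exists_logDiscount_eq hg hl
        rw [biasedLogMGF_logDiscount hg hL, ← EReal.coe_sub, EReal.coe_le_coe_iff, mul_comm]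
        exact mul_logDiscount_sub_le hg ha L
      · refine (EReal.sub_le_sub le_rfl (mul_le_biasedLogMGF hg hl)).trans ?_
        rw [← EReal.coe_sub, EReal.coe_le_coe_iff]
        nlinarith
    · have hL := optExponent_neg hg ha ha'
      refine le_iSup_of_le (logDiscount g (optExponent g a)) ?_
      rw [biasedLogMGF_logDiscount hg hL, ← EReal.coe_sub, EReal.coe_le_coe_iff, mul_comm]
  rw [biasedRate, hsup, EReal.toReal_coe]

end Rate

/-! ### The two asymptotic statements -/

lemma exists_infMeanHit_eq {C g : ℝ} (hC : 1 < C) (hg : 1 < g) :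
    ∃ f : ℕ → ℝ, f =O[atTop] (fun _ : ℕ => (1 : ℝ)) ∧
      ∀ n : ℕ, ((WeightedGraph.infMeanHit.{u} C g n : ℝ≥0∞) : EReal) =
        ((biasedMean g hg * n + f n : ℝ) : EReal) := by
  have hm := one_le_biasedSlowness hg
  have hK := stepLoss_nonneg hC hg
  have hle := fun n => WeightedGraph.infMeanHit_le.{u} hC hg n
  have htop : ∀ n, WeightedGraph.infMeanHit.{u} C g n ≠ ∞ := fun n =>
    ((hle n).trans_lt ENNReal.ofReal_lt_top).ne
  refine ⟨fun n => (WeightedGraph.infMeanHit.{u} C g n).toReal - biasedSlowness g * n, ?_, ?_⟩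
  · refine IsBigO.of_bound (biasedSlowness g * stepLoss C g) ?_
    filter_upwards [eventually_ge_atTop 2, eventually_gt_atTop ⌈stepLoss C g⌉₊] with n hn hnK
    have hnK' : stepLoss C g < n := (Nat.le_ceil _).trans_lt (by exact_mod_cast hnK)
    have h1 := (ENNReal.ofReal_le_iff_le_toReal (htop n)).1
      (WeightedGraph.le_infMeanHit.{u} hC hg hn hnK')
    have h2 := ENNReal.toReal_le_of_le_ofReal (by positivity) (hle n)
    rw [norm_one, mul_one, Real.norm_eq_abs, abs_le]
    constructor
    · linarith
    · have : 0 ≤ biasedSlowness g * stepLoss C g := by positivity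
      linarith
  · intro n
    rw [biasedMean_eq, add_sub_cancel, EReal.coe_ennreal_toReal (htop n)]

/-- The entropic form of the rate function. -/
lemma optExponent_eq {g a : ℝ} (hg : 1 < g) (ha : 1 < a) :
    (a + 1) / 2 * Real.log (g / (g + 1) * a / ((a + 1) / 2)) +
      (a - 1) / 2 * Real.log ((1 - g / (g + 1)) * a / ((a - 1) / 2)) =
    -(a * logDiscount g (optExponent g a) - optExponent g a) := by
  have hg0 : 0 < g := by linarith
  have ha0 : 0 < a := by linarith
  have ha1 : 0 < a - 1 := by linarith
  have e1 : g / (g + 1) * a / ((a + 1) / 2) = g * (2 * a) / ((g + 1) * (a + 1)) := by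
    field_simp
  have e2 : (1 - g / (g + 1)) * a / ((a - 1) / 2) = 2 * a / ((g + 1) * (a - 1)) := by
    field_simp; ring
  have e3 : g + g * (a - 1) / (a + 1) = g * (2 * a) / (a + 1) := by
    field_simp; ring
  have l1 : Real.log (g * (2 * a) / ((g + 1) * (a + 1))) =
      Real.log g + Real.log (2 * a) - (Real.log (g + 1) + Real.log (a + 1)) := by
    rw [Real.log_div (by positivity) (by positivity), Real.log_mul hg0.ne' (by positivity),
      Real.log_mul (by positivity : g + 1 ≠ 0) (by positivity)]
  have l2 : Real.log (2 * a / ((g + 1) * (a - 1))) =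
      Real.log (2 * a) - (Real.log (g + 1) + Real.log (a - 1)) := by
    rw [Real.log_div (by positivity) (by positivity),
      Real.log_mul (by positivity : g + 1 ≠ 0) (by positivity)]
  have l3 : Real.log (g * (2 * a) / (a + 1)) =
      Real.log g + Real.log (2 * a) - Real.log (a + 1) := by
    rw [Real.log_div (by positivity) (by positivity), Real.log_mul hg0.ne' (by positivity)]
  have l4 : Real.log (g * (a - 1) / (a + 1)) =
      Real.log g + Real.log (a - 1) - Real.log (a + 1) := by
    rw [Real.log_div (by positivity) (by positivity), Real.log_mul hg0.ne' (by positivity)]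
  rw [logDiscount, exp_two_mul_optExponent hg0 ha, e1, e2, e3, optExponent, l1, l2, l3, l4]
  ring

/-- The entropy bound for binomial probabilities: bounding (j+l)^(j+l) by the number of terms times
the largest one loses only a factor j + l + 1. -/
lemma binomialProb_lower {p : ℝ} (hp0 : 0 < p) (hp1 : p < 1) {j l : ℕ} (hj : 0 < j) (hl : 0 < l) :
    -Real.log (j + l + 1) + (j * Real.log (p * (j + l) / j) +
      l * Real.log ((1 - p) * (j + l) / l)) ≤ Real.log (binomialProb p (j + l) j) := by
  have hq : 0 < 1 - p := by linarith
  have hj' : (0 : ℝ) < j := by exact_mod_cast hj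
  have hl' : (0 : ℝ) < l := by exact_mod_cast hl
  have h : ((j + l : ℝ)) ^ (j + l) ≤ (j + l + 1) * ((j + l).choose j * (j ^ j * l ^ l)) := by
    exact_mod_cast pow_le_succ_mul_choose j l hl
  rw [← Real.log_inv, ← Real.log_pow, ← Real.log_pow, ← Real.log_mul (by positivity) (by positivity),
    ← Real.log_mul (by positivity) (by positivity)]
  refine Real.log_le_log (by positivity) ?_
  rw [binomialProb, Nat.add_sub_cancel_left, div_pow, div_pow, mul_pow, mul_pow,
    inv_mul_le_iff₀ (by positivity)]
  calc p ^ j * (j + l : ℝ) ^ j / j ^ j * ((1 - p) ^ l * (j + l : ℝ) ^ l / l ^ l)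
      = p ^ j * (1 - p) ^ l * ((j + l : ℝ) ^ (j + l)) / (j ^ j * l ^ l) := by
        rw [pow_add]; field_simp
    _ ≤ p ^ j * (1 - p) ^ l * ((j + l + 1) * ((j + l).choose j * (j ^ j * l ^ l))) / (j ^ j * l ^ l) := by
        gcongr
    _ = _ := by field_simp

lemma exists_supProbHitLE_eq {C g : ℝ} (hC : 1 < C) (hg : 1 < g) {a : ℝ} (ha : 1 < a)
    (ha' : a < biasedSlowness g) :
    ∃ h : ℕ → ℝ, h =o[atTop] (fun n : ℕ => (n : ℝ)) ∧
      ∀ n : ℕ, WeightedGraph.supProbHitLE.{u} C g n (a * n) =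
        ENNReal.ofReal (Real.exp (-biasedRate g hg a * n + h n)) := by
  set J := biasedRate g hg a with hJ
  have hJ' : J = a * logDiscount g (optExponent g a) - optExponent g a := biasedRate_eq hg ha ha'
  have hL := optExponent_neg hg ha ha'
  have hK := stepLoss_nonneg hC hg
  set L := optExponent g a with hLdef
  set S : ℕ → ℝ := fun n => (WeightedGraph.supProbHitLE.{u} C g n (a * n)).toReal with hS
  have htop : ∀ n, WeightedGraph.supProbHitLE.{u} C g n (a * n) ≠ ∞ := fun n =>
    ((WeightedGraph.supProbHitLE_le_one C g n _).trans_lt ENNReal.one_lt_top).ne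
  have hSpos : ∀ n, 0 < S n := fun n =>
    ENNReal.toReal_pos (WeightedGraph.supProbHitLE_pos hC hg n ha).ne' (htop n)
  set h : ℕ → ℝ := fun n => Real.log (S n) + J * n with hh
  have hcast : Tendsto (fun n : ℕ => (n : ℝ)) atTop atTop := tendsto_natCast_atTop_atTop
  -- the upper bound
  have hupper : ∀ᶠ n : ℕ in atTop, h n / n ≤ a * (logDiscount g L - logDiscount g L /
      (1 - stepLoss C g / n)) := by
    filter_upwards [eventually_ge_atTop 2, eventually_gt_atTop ⌈stepLoss C g⌉₊] with n hn hnK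
    have hnK' : stepLoss C g < n := (Nat.le_ceil _).trans_lt (by exact_mod_cast hnK)
    have hn0 : (0 : ℝ) < n := by positivity
    have h1 := ENNReal.toReal_le_of_le_ofReal (Real.exp_pos _).le
      (WeightedGraph.supProbHitLE_le.{u} hC hg hn hnK' (show 0 ≤ a by linarith) hL)
    have h2 := (Real.log_le_iff_le_exp (hSpos n)).2 h1
    rw [div_le_iff₀ hn0]
    simp only [hh]
    rw [hJ']
    linarith
  have hupper_lim : Tendsto (fun n : ℕ => a * (logDiscount g L - logDiscount g L /
      (1 - stepLoss C g / n))) atTop (nhds 0) := by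
    have h1 : Tendsto (fun n : ℕ => stepLoss C g / n) atTop (nhds 0) :=
      tendsto_const_nhds.div_atTop hcast
    have h2 := ((tendsto_const_nhds (x := logDiscount g L)).sub
      ((tendsto_const_nhds (x := logDiscount g L)).div (tendsto_const_nhds.sub h1)
        (by simp : (1 : ℝ) - 0 ≠ 0))).const_mul a
    simpa using h2
  -- the lower bound
  set p := g / (g + 1) with hp
  have hp0 : 0 < p := by positivity
  have hp1 : p < 1 := by rw [hp, div_lt_one (by linarith)]; linarith
  -- A path from 0 to n in about a n steps makes about b n steps to the right and (b - 1) n to the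
  -- left. Rounding b n down keeps the number 2 j - n of steps at most a n.
  set b := (a + 1) / 2 with hb
  have hb1 : 1 < b := by rw [hb]; linarith
  set j : ℕ → ℕ := fun n => ⌊b * n⌋₊ with hj
  set x : ℕ → ℝ := fun n => (j n : ℝ) / n with hx
  have hxlim : Tendsto x atTop (nhds b) :=
    (tendsto_nat_floor_mul_div_atTop (show 0 ≤ b by linarith)).comp hcast
  have hlower : ∀ᶠ n : ℕ in atTop, -(Real.log ((a + 1) * n) / n) + (x n * Real.log (p * (2 * x n - 1) / x n) +
      (x n - 1) * Real.log ((1 - p) * (2 * x n - 1) / (x n - 1))) + J ≤ h n / n := by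
    filter_upwards [eventually_ge_atTop 1, hxlim.eventually (lt_mem_nhds hb1)] with n hn hxn
    have hn0 : (0 : ℝ) < n := by positivity
    have hjn : n < j n := by
      simp only [hx] at hxn
      rw [lt_div_iff₀ hn0, one_mul] at hxn
      exact_mod_cast hxn
    obtain ⟨l, hl⟩ : ∃ l, j n = n + l := ⟨j n - n, by omega⟩
    have hl0 : 0 < l := by omega
    have hle : (j n : ℝ) ≤ b * n := Nat.floor_le (by positivity)
    have hlr : (l : ℝ) = j n - n := by rw [hl]; push_cast; ring
    have h1 := WeightedGraph.binomialProb_le_supProbHitLE.{u} (t := a * n) hC hg hn (by positivity)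
      (k := j n + l) (j := j n) (by push_cast; rw [hlr]; rw [hb] at hle; linarith) (by omega)
    have h2 := (ENNReal.ofReal_le_iff_le_toReal (htop n)).1 h1
    have hbpos : 0 < binomialProb p (j n + l) (j n) := by
      have : 0 < (j n + l).choose (j n) := Nat.choose_pos (by omega)
      have : 0 < 1 - p := by linarith
      unfold binomialProb
      positivity
    have h3 := (binomialProb_lower hp0 hp1 (show 0 < j n by omega) hl0).trans
      (Real.log_le_log hbpos h2)
    have hxj : (j n : ℝ) = x n * n := by simp only [hx]; field_simp
    have hxl : (l : ℝ) = (x n - 1) * n := by rw [hlr, hxj]; ring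
    have h4 : Real.log (j n + l + 1) ≤ Real.log ((a + 1) * n) := by
      refine Real.log_le_log (by positivity) ?_
      rw [hlr]
      have : (1 : ℝ) ≤ n := by exact_mod_cast hn
      rw [hb] at hle
      linarith
    have e1 : p * (j n + l) / j n = p * (2 * x n - 1) / x n := by
      rw [hxl, hxj]; field_simp; ring
    have e2 : (1 - p) * (j n + l) / l = (1 - p) * (2 * x n - 1) / (x n - 1) := by
      have : x n - 1 ≠ 0 := by linarith
      rw [hxl, hxj]; field_simp; ring
    rw [e1, e2, hxl, hxj] at h3
    rw [hxl, hxj] at h4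
    rw [le_div_iff₀ hn0]
    simp only [hh]
    have h5 : (-(Real.log ((a + 1) * n) / n) + (x n * Real.log (p * (2 * x n - 1) / x n) +
      (x n - 1) * Real.log ((1 - p) * (2 * x n - 1) / (x n - 1))) + J) * n =
      -Real.log ((a + 1) * n) + (x n * n * Real.log (p * (2 * x n - 1) / x n) +
      (x n - 1) * n * Real.log ((1 - p) * (2 * x n - 1) / (x n - 1))) + J * n := by
      field_simp
    rw [h5]
    linarith
  have hlower_lim : Tendsto (fun n : ℕ => -(Real.log ((a + 1) * n) / n) +
      (x n * Real.log (p * (2 * x n - 1) / x n) +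
      (x n - 1) * Real.log ((1 - p) * (2 * x n - 1) / (x n - 1))) + J) atTop (nhds 0) := by
    have hlog : Tendsto (fun n : ℕ => Real.log ((a + 1) * n) / n) atTop (nhds 0) := by
      have h1 : Tendsto (fun y : ℝ => (a + 1) * (Real.log y / y)) atTop (nhds 0) := by
        have := (Real.isLittleO_log_id_atTop.tendsto_div_nhds_zero).const_mul (a + 1)
        simpa using this
      have h2 := h1.comp (hcast.const_mul_atTop (show 0 < a + 1 by linarith))
      refine h2.congr fun n => ?_
      simp only [Function.comp]
      have : a + 1 ≠ 0 := by linarith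
      rw [mul_div_assoc', mul_div_mul_left _ _ this]
    have e0 : 2 * b - 1 = a := by rw [hb]; ring
    have e1 : b - 1 = (a - 1) / 2 := by rw [hb]; ring
    have ha0 : 0 < a := by linarith
    have hq : 0 < 1 - p := by linarith
    have hb0 : 0 < b := by linarith
    have hbb : 0 < b - 1 := by linarith
    have h2x : Tendsto (fun n => 2 * x n - 1) atTop (nhds (2 * b - 1)) :=
      (hxlim.const_mul 2).sub_const 1
    have hx1 := hxlim.sub_const 1
    have hl1 := ((h2x.const_mul p).div hxlim hb0.ne').log (by rw [e0]; positivity)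
    have hl2 := ((h2x.const_mul (1 - p)).div hx1 hbb.ne').log (by rw [e0]; positivity)
    have := (hlog.neg.add ((hxlim.mul hl1).add (hx1.mul hl2))).add_const J
    -- At the limiting proportions the entropy exponent is exactly -J, so the lower bound tends to
    -- 0.
    have hval : -(0 : ℝ) + (b * Real.log (p * (2 * b - 1) / b) +
        (b - 1) * Real.log ((1 - p) * (2 * b - 1) / (b - 1))) + J = 0 := by
      rw [e0, e1, hb, hp, optExponent_eq hg ha, hJ']
      ring
    rw [hval] at this
    exact this
  refine ⟨h, ?_, fun n => ?_⟩
  · rw [isLittleO_iff_tendsto' (by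
      filter_upwards [eventually_ge_atTop 1] with n hn h0
      have : (n : ℝ) = 0 := h0
      norm_cast at this
      omega)]
    exact tendsto_of_tendsto_of_tendsto_of_le_of_le' hlower_lim hupper_lim hlower hupper
  · simp only [hh]
    rw [show -J * n + (Real.log (S n) + J * n) = Real.log (S n) by ring, Real.exp_log (hSpos n),
      ENNReal.ofReal_toReal (htop n)]

end

theorem corollary3 (C g : ℝ) (hC : 1 < C) (hg : 1 < g) :
    (∃ f : ℕ → ℝ, f =O[atTop] (fun _ : ℕ => (1 : ℝ)) ∧
      ∀ n : ℕ, ((WeightedGraph.infMeanHit.{u} C g n : ℝ≥0∞) : EReal) =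
        ((biasedMean g hg * n + f n : ℝ) : EReal)) ∧
    ∀ a : ℝ, 1 < a → a < biasedMean g hg →
      ∃ h : ℕ → ℝ, h =o[atTop] (fun n : ℕ => (n : ℝ)) ∧
        ∀ n : ℕ, WeightedGraph.supProbHitLE.{u} C g n (a * n) =
          ENNReal.ofReal (Real.exp (-biasedRate g hg a * n + h n)) := by
  refine ⟨exists_infMeanHit_eq hC hg, fun a ha ha' => ?_⟩
  rw [biasedMean_eq] at ha'
  exact exists_supProbHitLE_eq hC hg ha ha'
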